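/- Let $a\in(\tfrac12,1)$ and $p=\tfrac{1+a}{2}$. Let $(X_n)_{n\ge1}$ be the steps of the one-dimensional elephant random walk with memory parameter $p$ that starts to the right: $X_1=1$ a.s., and for each $n\ge1$ one draws $K$ uniformly in $\{1,\dots,n\}$ and an independent Bernoulli variable $\xi$ with parameter $p$, the pair $(K,\xi)$ being independent of $(X_1,\dots,X_n)$, and sets $X_{n+1}=(2\xi-1)X_K$. Let $S_n=X_1+\dots+X_n$. Then $S_n/n^a$ converges almost surely to a random variable $L_1$, and the law of $L_1$ is the unique probability distribution $\mu$ on $\mathbb R$ with finite second moment and expectation $\frac1{\Gamma(1+a)}$ that satisfies the distributional equation $$Y\overset{\mathcal L}{=}V^aY^{(1)}+(2\xi_p-1)(1-V)^aY^{(2)},$$ where $Y,Y^{(1)},Y^{(2)}$ have law $\mu$, $V$ is uniform on $[0,1]$, $\xi_p$ is Bernoulli with parameter $p$, and $V,\xi_p,Y^{(1)},Y^{(2)}$ are independent. Moreover, for every $m\in\mathbb R$, let $\mathcal P_2(m)$ be the set of probability distributions on $\mathbb R$ with finite second moment and expectation $m$, let $H$ map $\mu$ to the law of the right-hand side above, and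 let $d_{\mathcal W}(\mu,\nu)=\inf\sqrt{\mathbb E[(X-Y)^2]}$, the infimum being over random vectors $(X,Y)$ with marginal distributions $\mu$ and $\nu$. Then $H$ maps $\mathcal P_2(m)$ to itself and $d_{\mathcal W}(H\mu,H\nu)\le\sqrt{\tfrac{2}{1+2a}}\;d_{\mathcal W}(\mu,\nu)$ for all $\mu,\nu\in\mathcal P_2(m)$, where $\sqrt{\tfrac{2}{1+2a}}<1$. -/

import Mathlib

open MeasureTheory ProbabilityTheory Filter Topology
open scoped unitInterval ENNReal

noncomputable section

/-- `X 1, X 2, …` are the steps of a one-dimensional elephant random walk with memory parameter `p`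
and first step parameter `q` on the probability space `(Ω, P)` (the variable `X 0` is not used).
The first step is `+1` with probability `q` and `-1` with probability `1 - q`. Then, for `n ≥ 1`,
the walker draws a time `K` uniformly in `{1, …, n}` and an independent Bernoulli variable `ξ` with
parameter `p`, the pair being independent of the first `n` steps, and repeats the step made at time
`K` if `ξ = 1`, and makes the opposite step if `ξ = 0`. -/
structure IsElephantWalk {Ω : Type*} [MeasurableSpace Ω] (p q : I) (X : ℕ → Ω → ℝ)
    (P : Measure Ω) : Prop where
  measurable : ∀ n, 1 ≤ n → Measurable (X n)
  first_step : HasLaw (X 1) (bernoulliMeasure (1 : ℝ) (-1) q) P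
  next_step : ∀ n, 1 ≤ n → ∃ (K : Ω → ℕ) (ξ : Ω → ℝ), Measurable K ∧ Measurable ξ ∧
    HasLaw K (uniformOn (Set.Icc 1 n)) P ∧
    HasLaw ξ (bernoulliMeasure (1 : ℝ) 0 p) P ∧
    IndepFun K ξ P ∧
    IndepFun (fun ω => (K ω, ξ ω)) (fun ω (i : Finset.Icc 1 n) => X i ω) P ∧
    ∀ᵐ ω ∂P, X (n + 1) ω = (2 * ξ ω - 1) * X (K ω) ω

/-- The position `S_n = X_1 + ⋯ + X_n` at time `n` of the walk with steps `X`. -/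
def walkPosition {Ω : Type*} (X : ℕ → Ω → ℝ) (n : ℕ) (ω : Ω) : ℝ :=
  ∑ k ∈ Finset.Icc 1 n, X k ω

/-- The law of `V ^ a * Y₁ + (2 * ξ - 1) * (1 - V) ^ a * Y₂`, where `V` is uniform on `[0, 1]`, `ξ` is
Bernoulli with parameter `p`, `Y₁` and `Y₂` have law `μ`, and the four variables are independent. -/
def smoothingMap (p : I) (a : ℝ) (μ : Measure ℝ) : Measure ℝ :=
  (((volume : Measure ℝ).restrict (Set.Icc 0 1)).prod
    ((bernoulliMeasure (1 : ℝ) 0 p).prod (μ.prod μ))).map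
    (fun z : ℝ × ℝ × ℝ × ℝ =>
      z.1 ^ a * z.2.2.1 + (2 * z.2.1 - 1) * (1 - z.1) ^ a * z.2.2.2)

/-- The set of probability distributions on the real line with finite second moment and with
expectation `m`. -/
def lawsWithMean (m : ℝ) : Set (Measure ℝ) :=
  {μ | IsProbabilityMeasure μ ∧ MemLp (fun x : ℝ => x) 2 μ ∧ ∫ x, x ∂μ = m}

/-- The Wasserstein distance of order two: the infimum of `(𝔼 |X - Y|²)^(1/2)` over all random
vectors `(X, Y)` with marginal distributions `μ` and `ν`. -/
def wassersteinTwo (μ ν : Measure ℝ) : ℝ≥0∞ :=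
  ⨅ (π : Measure (ℝ × ℝ)) (_ : π.map Prod.fst = μ ∧ π.map Prod.snd = ν),
    (∫⁻ z, edist z.1 z.2 ^ 2 ∂π) ^ (1 / 2 : ℝ)

end

/-! ### The smoothing map -/

/-! Uniqueness is a contraction argument. Given a coupling of `μ` and `ν`, two independent samples
of it are fed into the smoothing map with the same `V` and `ξ`. Equal means make the difference `D`
of the coordinates centred, so the cross term vanishes in L², and `E V^(2a) = E (1-V)^(2a) =
1/(1+2a)` gives the squared factor `2/(1+2a)`, below 1 because `a > 1/2`
(`wassersteinTwo_smoothingMap_le`). Two fixed points with the same mean are thus at distance 0, and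
the distance dominates differences of characteristic functions; neither optimal couplings nor
completeness are needed.

Existence comes from the walk itself. `S_{n+1} / ∏_{k≤n} (1 + a/k)` is an L²-bounded martingale, and
the product is asymptotic to `n^a / Γ(1+a)`; this gives the limit and its mean (`exists_limit`).

That the limit law is a fixed point rests on a finite splitting (`charFun_walkPosition_split`):
`S_{n+1}` has the law of a uniformly chosen mixture of a walk of length `k` plus an independent,
randomly signed walk of length `n+1-k`. Heuristically, these are the two parts of the tree of copied
steps obtained by cutting the edge between steps 1 and 2. The proof is analytic: the characteristic
functions solve a first-order recursion in `n` and `t`, which is compatible with convolution in `n`.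
Rescaling by `n^a`, with `k/n` tending to a uniform variable, yields the fixed point equation
(`map_limit_eq_smoothingMap`).

Uniqueness then makes the limit law independent of the probability space, and an explicit walk shows
that this law exists. -/

section ProductIntegrals

variable {α β γ δ : Type*} [MeasurableSpace α] [MeasurableSpace β] [MeasurableSpace γ]
  [MeasurableSpace δ] {μ₁ : Measure α} {μ₂ : Measure β} {μ₃ : Measure γ} {μ₄ : Measure δ}

theorem integrable_mul_prod_four {f : α → ℝ} {g : β → ℝ} {h : γ → ℝ} {k : δ → ℝ}
    (hf : Integrable f μ₁) (hg : Integrable g μ₂) (hh : Integrable h μ₃) (hk : Integrable k μ₄) :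
    Integrable (fun z : α × β × γ × δ => f z.1 * (g z.2.1 * (h z.2.2.1 * k z.2.2.2)))
      (μ₁.prod (μ₂.prod (μ₃.prod μ₄))) :=
  hf.mul_prod (hg.mul_prod (hh.mul_prod hk))

theorem integral_mul_prod_four [SFinite μ₁] [SFinite μ₂] [SFinite μ₃] [SFinite μ₄]
    (f : α → ℝ) (g : β → ℝ) (h : γ → ℝ) (k : δ → ℝ) :
    ∫ z : α × β × γ × δ, f z.1 * (g z.2.1 * (h z.2.2.1 * k z.2.2.2))
      ∂(μ₁.prod (μ₂.prod (μ₃.prod μ₄))) =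
      (∫ x, f x ∂μ₁) * ((∫ x, g x ∂μ₂) * ((∫ x, h x ∂μ₃) * ∫ x, k x ∂μ₄)) := by
  rw [integral_prod_mul f (fun z : β × γ × δ => g z.1 * (h z.2.1 * k z.2.2)),
    integral_prod_mul g (fun z : γ × δ => h z.1 * k z.2), integral_prod_mul]

end ProductIntegrals

theorem integrable_Icc_rpow {a : ℝ} (ha : 0 < a) :
    Integrable (fun v : ℝ => v ^ a) (volume.restrict (Set.Icc 0 1)) :=
  ((Real.continuous_rpow_const ha.le).continuousOn).integrableOn_compact isCompact_Icc

theorem integrable_Icc_one_sub_rpow {a : ℝ} (ha : 0 < a) :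
    Integrable (fun v : ℝ => (1 - v) ^ a) (volume.restrict (Set.Icc 0 1)) :=
  (((Real.continuous_rpow_const ha.le).comp
    (continuous_const.sub continuous_id)).continuousOn).integrableOn_compact isCompact_Icc

theorem integral_Icc_rpow {a : ℝ} (ha : 0 < a) :
    ∫ v in Set.Icc (0 : ℝ) 1, v ^ a = 1 / (1 + a) := by
  rw [integral_Icc_eq_integral_Ioc, ← intervalIntegral.integral_of_le zero_le_one,
    integral_rpow (Or.inl (by linarith)), Real.zero_rpow (by linarith), Real.one_rpow]
  ring

theorem integral_Icc_one_sub_rpow {a : ℝ} (ha : 0 < a) :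
    ∫ v in Set.Icc (0 : ℝ) 1, (1 - v) ^ a = 1 / (1 + a) := by
  rw [← integral_Icc_rpow ha, integral_Icc_eq_integral_Ioc, integral_Icc_eq_integral_Ioc,
    ← intervalIntegral.integral_of_le zero_le_one, ← intervalIntegral.integral_of_le zero_le_one,
    intervalIntegral.integral_comp_sub_left (fun v : ℝ => v ^ a)]
  simp

theorem integrable_Icc_rpow_mul_one_sub_rpow {a : ℝ} (ha : 0 < a) :
    Integrable (fun v : ℝ => v ^ a * (1 - v) ^ a) (volume.restrict (Set.Icc 0 1)) :=
  (((Real.continuous_rpow_const ha.le).mul ((Real.continuous_rpow_const ha.le).comp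
    (continuous_const.sub continuous_id))).continuousOn).integrableOn_compact isCompact_Icc

instance isProbabilityMeasure_restrict_Icc :
    IsProbabilityMeasure ((volume : Measure ℝ).restrict (Set.Icc 0 1)) :=
  ⟨by simp⟩

/-- The noise `(V, ξ)` together with two independent copies of a sample from `ρ`. -/
noncomputable abbrev smoothingNoise (p : I) {E : Type*} [MeasurableSpace E] (ρ : Measure E) :
    Measure (ℝ × ℝ × E × E) :=
  ((volume : Measure ℝ).restrict (Set.Icc 0 1)).prod
    ((bernoulliMeasure (1 : ℝ) 0 p).prod (ρ.prod ρ))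

/-- The combination `V ^ a * D(Y₁) + (2 * ξ - 1) * (1 - V) ^ a * D(Y₂)`. -/
noncomputable def smoothingCombination (a : ℝ) {E : Type*} (D : E → ℝ) (z : ℝ × ℝ × E × E) : ℝ :=
  z.1 ^ a * D z.2.2.1 + (2 * z.2.1 - 1) * (1 - z.1) ^ a * D z.2.2.2

theorem measurable_smoothingCombination (a : ℝ) {E : Type*} [MeasurableSpace E] {D : E → ℝ}
    (hD : Measurable D) : Measurable (smoothingCombination a D) := by
  unfold smoothingCombination
  fun_prop

theorem smoothingMap_eq_map (p : I) (a : ℝ) (μ : Measure ℝ) :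
    smoothingMap p a μ = (smoothingNoise p μ).map (smoothingCombination a id) :=
  rfl

section Moments

variable {E : Type*} [MeasurableSpace E] {ρ : Measure E} {D : E → ℝ} {p : I} {a : ℝ}

/-- Both powers integrate to `1/(1+a)` and `2ξ-1` has mean `2p-1 = a`, so the weights add up to
`(1+a)/(1+a) = 1`. -/
theorem integral_smoothingCombination [IsProbabilityMeasure ρ] (hap : a = 2 * (p : ℝ) - 1)
    (ha : 0 < a) (hD : Integrable D ρ) :
    ∫ z, smoothingCombination a D z ∂smoothingNoise p ρ = ∫ x, D x ∂ρ := by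
  have hB (f : ℝ → ℝ) := integrable_bernoulliMeasure (1 : ℝ) 0 p f
  -- The constant factors 1 put each summand in the shape of a product over all four variables.
  have e : smoothingCombination a D = fun z : ℝ × ℝ × E × E =>
      z.1 ^ a * ((fun _ => 1 : ℝ → ℝ) z.2.1 * (D z.2.2.1 * (fun _ => 1 : E → ℝ) z.2.2.2)) +
      (1 - z.1) ^ a * ((2 * z.2.1 - 1) * ((fun _ => 1 : E → ℝ) z.2.2.1 * D z.2.2.2)) := by
    funext z
    simp only [smoothingCombination]
    ring
  have i1 := integrable_mul_prod_four (integrable_Icc_rpow ha) (hB fun _ => 1) hD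
    (integrable_const (μ := ρ) (1 : ℝ))
  have i2 := integrable_mul_prod_four (integrable_Icc_one_sub_rpow ha) (hB fun b => 2 * b - 1)
    (integrable_const (μ := ρ) (1 : ℝ)) hD
  rw [e]
  refine (integral_add i1 i2).trans ?_
  rw [integral_mul_prod_four (fun v : ℝ => v ^ a) (fun _ : ℝ => 1) D (fun _ : E => 1),
    integral_mul_prod_four (fun v : ℝ => (1 - v) ^ a) (fun b : ℝ => 2 * b - 1) (fun _ : E => 1) D,
    integral_Icc_rpow ha, integral_Icc_one_sub_rpow ha, integral_bernoulliMeasure,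
    integral_bernoulliMeasure]
  simp only [integral_const, probReal_univ, smul_eq_mul]
  have : 1 + a ≠ 0 := by positivity
  field_simp
  rw [hap]
  ring

/-- Only almost everywhere: `x^(2a) = (x^a)^2` is used for `x = v` and `x = 1-v`, which must be
nonnegative. -/
theorem smoothingCombination_sq_ae :
    (fun z => smoothingCombination a D z ^ 2) =ᵐ[smoothingNoise p ρ] fun z =>
      z.1 ^ (2 * a) * ((fun _ => 1 : ℝ → ℝ) z.2.1 *
        ((fun x => D x ^ 2) z.2.2.1 * (fun _ => 1 : E → ℝ) z.2.2.2)) +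
      (1 - z.1) ^ (2 * a) * ((2 * z.2.1 - 1) ^ 2 *
        ((fun _ => 1 : E → ℝ) z.2.2.1 * (fun x => D x ^ 2) z.2.2.2)) +
      z.1 ^ a * (1 - z.1) ^ a * (2 * (2 * z.2.1 - 1) * (D z.2.2.1 * D z.2.2.2)) := by
  have h : ∀ᵐ z ∂smoothingNoise p ρ, z.1 ∈ Set.Icc (0 : ℝ) 1 :=
    Measure.quasiMeasurePreserving_fst.ae (ae_restrict_mem measurableSet_Icc)
  filter_upwards [h] with z hz
  have h1 : z.1 ^ (2 * a) = (z.1 ^ a) ^ 2 := by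
    rw [mul_comm, Real.rpow_mul hz.1, Real.rpow_two]
  have h2 : (1 - z.1) ^ (2 * a) = ((1 - z.1) ^ a) ^ 2 := by
    rw [mul_comm, Real.rpow_mul (by linarith [hz.2]), Real.rpow_two]
  simp only [smoothingCombination, h1, h2]
  ring

theorem memLp_smoothingCombination [IsProbabilityMeasure ρ] (ha : 0 < a) (hDm : Measurable D)
    (hD : MemLp D 2 ρ) :
    MemLp (smoothingCombination a D) 2 (smoothingNoise p ρ) := by
  have hB (f : ℝ → ℝ) := integrable_bernoulliMeasure (1 : ℝ) 0 p f
  have hD1 := hD.integrable (by norm_num)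
  have ha2 : 0 < 2 * a := by positivity
  have i1 := integrable_mul_prod_four (integrable_Icc_rpow ha2) (hB (fun _ => 1)) hD.integrable_sq
    (integrable_const (μ := ρ) (1 : ℝ))
  have i2 := integrable_mul_prod_four (integrable_Icc_one_sub_rpow ha2)
    (hB (fun b => (2 * b - 1) ^ 2)) (integrable_const (μ := ρ) (1 : ℝ)) hD.integrable_sq
  have i3 := integrable_mul_prod_four (integrable_Icc_rpow_mul_one_sub_rpow ha)
      (hB (fun b => 2 * (2 * b - 1))) hD1 hD1
  rw [memLp_two_iff_integrable_sq (measurable_smoothingCombination a hDm).aestronglyMeasurable,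
    integrable_congr smoothingCombination_sq_ae]
  exact (i1.add i2).add i3

/-- The cross term carries the factor `(∫ D)^2 = 0`, and `(2ξ-1)^2 = 1`, which leaves two equal
terms. The contraction takes for `D` the difference of coordinates on the space of a coupling,
whence the general `E`. -/
theorem integral_smoothingCombination_sq [IsProbabilityMeasure ρ] (ha : 0 < a) (hD : MemLp D 2 ρ)
    (h0 : ∫ x, D x ∂ρ = 0) :
    ∫ z, smoothingCombination a D z ^ 2 ∂smoothingNoise p ρ =
      2 / (1 + 2 * a) * ∫ x, D x ^ 2 ∂ρ := by
  have hB (f : ℝ → ℝ) := integrable_bernoulliMeasure (1 : ℝ) 0 p f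
  have hD1 := hD.integrable (by norm_num)
  have ha2 : 0 < 2 * a := by positivity
  have i1 := integrable_mul_prod_four (integrable_Icc_rpow ha2) (hB (fun _ => 1)) hD.integrable_sq
    (integrable_const (μ := ρ) (1 : ℝ))
  have i2 := integrable_mul_prod_four (integrable_Icc_one_sub_rpow ha2)
    (hB (fun b => (2 * b - 1) ^ 2)) (integrable_const (μ := ρ) (1 : ℝ)) hD.integrable_sq
  have i3 := integrable_mul_prod_four (integrable_Icc_rpow_mul_one_sub_rpow ha)
      (hB (fun b => 2 * (2 * b - 1))) hD1 hD1
  refine (integral_congr_ae smoothingCombination_sq_ae).trans ?_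
  refine (integral_add (i1.add i2) i3).trans ?_
  refine (congrArg (· + _) (integral_add i1 i2)).trans ?_
  rw [integral_mul_prod_four (fun v : ℝ => v ^ (2 * a)) (fun _ : ℝ => 1) (fun x => D x ^ 2)
      (fun _ : E => 1),
    integral_mul_prod_four (fun v : ℝ => (1 - v) ^ (2 * a)) (fun b : ℝ => (2 * b - 1) ^ 2)
      (fun _ : E => 1) (fun x => D x ^ 2),
    integral_mul_prod_four (fun v : ℝ => v ^ a * (1 - v) ^ a) (fun b : ℝ => 2 * (2 * b - 1)) D D,
    h0, integral_Icc_rpow ha2, integral_Icc_one_sub_rpow ha2, integral_bernoulliMeasure,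
    integral_bernoulliMeasure]
  simp only [integral_const, probReal_univ, smul_eq_mul]
  ring

end Moments

theorem smoothingMap_mem_lawsWithMean {p : I} {a m : ℝ} (hap : a = 2 * (p : ℝ) - 1) (ha : 0 < a)
    {μ : Measure ℝ} (hμ : μ ∈ lawsWithMean m) : smoothingMap p a μ ∈ lawsWithMean m := by
  obtain ⟨h1, h2, h3⟩ := hμ
  have hm : Measurable (smoothingCombination a (id : ℝ → ℝ)) :=
    measurable_smoothingCombination a measurable_id
  rw [smoothingMap_eq_map]
  refine ⟨Measure.isProbabilityMeasure_map hm.aemeasurable, ?_, ?_⟩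
  · rw [memLp_map_measure_iff (by fun_prop) hm.aemeasurable]
    exact memLp_smoothingCombination ha measurable_id h2
  · rw [integral_map hm.aemeasurable (by fun_prop),
      ← h3]
    exact integral_smoothingCombination hap ha (h2.integrable (by norm_num))

/-! ### Contraction in the Wasserstein distance -/

theorem map_smoothingNoise {p : I} {E F : Type*} [MeasurableSpace E] [MeasurableSpace F]
    {ρ : Measure E} [IsProbabilityMeasure ρ] {f : E → F} (hf : Measurable f) :
    (smoothingNoise p ρ).map (Prod.map id (Prod.map id (Prod.map f f))) =
      smoothingNoise p (ρ.map f) := by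
  have h : MeasurePreserving f ρ (ρ.map f) := ⟨hf, rfl⟩
  have := Measure.isProbabilityMeasure_map (μ := ρ) hf.aemeasurable
  exact ((MeasurePreserving.id _).prod ((MeasurePreserving.id _).prod (h.prod h))).map_eq

/-- With `ρ` a coupling and `f` a projection, this realises the images of both marginals on one
common noise space. -/
theorem smoothingMap_map {p : I} {a : ℝ} {E : Type*} [MeasurableSpace E]
    {ρ : Measure E} [IsProbabilityMeasure ρ] {f : E → ℝ} (hf : Measurable f) :
    smoothingMap p a (ρ.map f) = (smoothingNoise p ρ).map (smoothingCombination a f) := by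
  rw [smoothingMap_eq_map, ← map_smoothingNoise hf, Measure.map_map
    (measurable_smoothingCombination a measurable_id) (by fun_prop)]
  rfl

/-- The `L²` transport cost of a coupling of two square integrable laws is a Bochner integral. -/
theorem lintegral_edist_sq_eq {α : Type*} [MeasurableSpace α] {ρ : Measure α} {f g : α → ℝ}
    (h : MemLp (fun x => f x - g x) 2 ρ) :
    ∫⁻ x, edist (f x) (g x) ^ 2 ∂ρ = ENNReal.ofReal (∫ x, (f x - g x) ^ 2 ∂ρ) := by
  rw [ofReal_integral_eq_lintegral_ofReal h.integrable_sq (ae_of_all _ fun x => sq_nonneg _)]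
  refine lintegral_congr fun x => ?_
  rw [edist_dist, Real.dist_eq, ← ENNReal.ofReal_pow (abs_nonneg _), sq_abs]

/-- The common mean `m` enters the contraction here: it centres the difference of the coordinates.
-/
theorem memLp_of_coupling {m : ℝ} {μ ν : Measure ℝ} (hμ : μ ∈ lawsWithMean m)
    (hν : ν ∈ lawsWithMean m) {π : Measure (ℝ × ℝ)} (h1 : π.map Prod.fst = μ)
    (h2 : π.map Prod.snd = ν) :
    IsProbabilityMeasure π ∧ MemLp (fun z : ℝ × ℝ => z.1 - z.2) 2 π ∧
      ∫ z, (z.1 - z.2) ∂π = 0 := by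
  obtain ⟨hμ1, hμ2, hμ3⟩ := hμ
  obtain ⟨hν1, hν2, hν3⟩ := hν
  rw [← h1] at hμ1 hμ2 hμ3
  rw [← h2] at hν2 hν3
  have hπ : IsProbabilityMeasure π := Measure.isProbabilityMeasure_of_map Prod.fst
  have l1 : MemLp (fun z : ℝ × ℝ => z.1) 2 π :=
    (memLp_map_measure_iff (f := Prod.fst) (by fun_prop) (by fun_prop)).1 hμ2
  have l2 : MemLp (fun z : ℝ × ℝ => z.2) 2 π :=
    (memLp_map_measure_iff (f := Prod.snd) (by fun_prop) (by fun_prop)).1 hν2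
  refine ⟨hπ, l1.sub l2, ?_⟩
  rw [integral_map (by fun_prop) (by fun_prop)] at hμ3 hν3
  rw [integral_sub (l1.integrable (by norm_num)) (l2.integrable (by norm_num)), hμ3, hν3, sub_self]

/-- Every coupling `π` induces the coupling `κ` of the images, with shared `V` and `ξ`, whose
squared cost is exactly `2/(1+2a)` times that of `π`. The infimum over `π` follows. -/
theorem wassersteinTwo_smoothingMap_le {p : I} {a m : ℝ} (ha : 0 < a)
    {μ ν : Measure ℝ} (hμ : μ ∈ lawsWithMean m) (hν : ν ∈ lawsWithMean m) :
    wassersteinTwo (smoothingMap p a μ) (smoothingMap p a ν) ≤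
      ENNReal.ofReal √(2 / (1 + 2 * a)) * wassersteinTwo μ ν := by
  have hc : 0 < 2 / (1 + 2 * a) := by positivity
  have hc0 : ENNReal.ofReal √(2 / (1 + 2 * a)) ≠ 0 := by
    simpa using Real.sqrt_pos.2 hc
  unfold wassersteinTwo
  rw [ENNReal.mul_iInf_of_ne hc0 ENNReal.ofReal_ne_top]
  refine le_iInf fun π => ?_
  rw [ENNReal.mul_iInf_of_ne hc0 ENNReal.ofReal_ne_top]
  refine le_iInf fun hπ => ?_
  obtain ⟨hP, hL, h0⟩ := memLp_of_coupling hμ hν hπ.1 hπ.2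
  have m1 : Measurable (smoothingCombination a (Prod.fst : ℝ × ℝ → ℝ)) :=
    measurable_smoothingCombination a measurable_fst
  have m2 : Measurable (smoothingCombination a (Prod.snd : ℝ × ℝ → ℝ)) :=
    measurable_smoothingCombination a measurable_snd
  set κ : Measure (ℝ × ℝ) := (smoothingNoise p π).map
    (fun z => (smoothingCombination a Prod.fst z, smoothingCombination a Prod.snd z)) with hκ
  have k1 : κ.map Prod.fst = smoothingMap p a μ := by
    rw [hκ, Measure.map_map measurable_fst (m1.prodMk m2), ← hπ.1, smoothingMap_map measurable_fst]
    rfl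
  have k2 : κ.map Prod.snd = smoothingMap p a ν := by
    rw [hκ, Measure.map_map measurable_snd (m1.prodMk m2), ← hπ.2, smoothingMap_map measurable_snd]
    rfl
  refine (iInf₂_le κ ⟨k1, k2⟩).trans ?_
  have e : (fun z => smoothingCombination a Prod.fst z - smoothingCombination a Prod.snd z) =
      smoothingCombination a (fun z : ℝ × ℝ => z.1 - z.2) := by
    funext z
    simp only [smoothingCombination]
    ring
  have hL' : MemLp (fun z => smoothingCombination a Prod.fst z - smoothingCombination a Prod.snd z)
      2 (smoothingNoise p π) := by
    rw [e]
    exact memLp_smoothingCombination ha (by fun_prop) hL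
  have e' : ∫ z, (smoothingCombination a Prod.fst z - smoothingCombination a Prod.snd z) ^ 2
      ∂smoothingNoise p π = 2 / (1 + 2 * a) * ∫ z, (z.1 - z.2) ^ 2 ∂π := by
    rw [← integral_smoothingCombination_sq ha hL h0, ← e]
  rw [hκ, lintegral_map (by fun_prop) (m1.prodMk m2), lintegral_edist_sq_eq hL',
    lintegral_edist_sq_eq hL, e', ENNReal.ofReal_mul hc.le,
    ENNReal.mul_rpow_of_nonneg _ _ (by norm_num), ENNReal.ofReal_rpow_of_pos hc,
    ← Real.sqrt_eq_rpow]

/-! ### Uniqueness of the fixed point -/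

/-- Under any coupling, `|e^(itx) - e^(ity)| ≤ |t||x-y|`, and Cauchy-Schwarz bounds the mean of
`|x-y|`. This shows that distance zero forces equality without an optimal coupling. -/
theorem norm_charFun_sub_charFun_le {m : ℝ} {μ ν : Measure ℝ} (hμ : μ ∈ lawsWithMean m)
    (hν : ν ∈ lawsWithMean m) (t : ℝ) :
    ENNReal.ofReal ‖charFun μ t - charFun ν t‖ ≤ ENNReal.ofReal |t| * wassersteinTwo μ ν := by
  -- The factor `|t|` can be moved inside the infimum only when it is nonzero.
  rcases eq_or_ne t 0 with rfl | ht
  · have := hμ.1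
    have := hν.1
    simp
  have ht0 : ENNReal.ofReal |t| ≠ 0 := by simpa using ht
  unfold wassersteinTwo
  rw [ENNReal.mul_iInf_of_ne ht0 ENNReal.ofReal_ne_top]
  refine le_iInf fun π => ?_
  rw [ENNReal.mul_iInf_of_ne ht0 ENNReal.ofReal_ne_top]
  refine le_iInf fun hπ => ?_
  obtain ⟨hP, hL, h0⟩ := memLp_of_coupling hμ hν hπ.1 hπ.2
  rw [lintegral_edist_sq_eq hL, ENNReal.ofReal_rpow_of_nonneg (integral_nonneg fun _ => sq_nonneg _)
    (by norm_num), ← Real.sqrt_eq_rpow, ← ENNReal.ofReal_mul (abs_nonneg _)]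
  refine ENNReal.ofReal_le_ofReal ?_
  have hb (f : ℝ × ℝ → ℝ) (hf : Measurable f) :
      Integrable (fun z => Complex.exp (t * f z * Complex.I)) π := by
    refine Integrable.of_bound (by fun_prop) 1 (ae_of_all _ fun z => ?_)
    rw [← Complex.ofReal_mul, Complex.norm_exp_ofReal_mul_I]
  have hpt (z : ℝ × ℝ) : ‖Complex.exp (t * z.1 * Complex.I) - Complex.exp (t * z.2 * Complex.I)‖ ≤
      |t| * |z.1 - z.2| := by
    have : Complex.exp (t * z.1 * Complex.I) - Complex.exp (t * z.2 * Complex.I) =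
        Complex.exp ((t * z.2 : ℝ) * Complex.I) *
          (Complex.exp (Complex.I * (t * (z.1 - z.2) : ℝ)) - 1) := by
      rw [mul_sub, ← Complex.exp_add, mul_one]
      push_cast
      ring_nf
    rw [this, norm_mul, Complex.norm_exp_ofReal_mul_I, one_mul, ← abs_mul]
    exact Real.norm_exp_I_mul_ofReal_sub_one_le
  have hL1 := hL.integrable (q := 2) (by norm_num)
  calc ‖charFun μ t - charFun ν t‖
      = ‖∫ z, (Complex.exp (t * z.1 * Complex.I) - Complex.exp (t * z.2 * Complex.I)) ∂π‖ := by
        rw [integral_sub (hb _ measurable_fst) (hb _ measurable_snd), ← hπ.1, ← hπ.2,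
          charFun_apply_real, charFun_apply_real, integral_map (by fun_prop) (by fun_prop),
          integral_map (by fun_prop) (by fun_prop)]
    _ ≤ ∫ z, |t| * |z.1 - z.2| ∂π :=
        norm_integral_le_of_norm_le (hL1.abs.const_mul _) (ae_of_all _ hpt)
    _ = |t| * ∫ z, |z.1 - z.2| ∂π := integral_const_mul _ _
    _ ≤ |t| * √(∫ z, (z.1 - z.2) ^ 2 ∂π) := by
        gcongr
        refine Real.le_sqrt_of_sq_le ?_
        -- Cauchy-Schwarz, in the form that the variance of `|x-y|` is nonnegative.
        have := variance_nonneg (fun z : ℝ × ℝ => |z.1 - z.2|) π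
        rw [variance_eq_sub (X := fun z : ℝ × ℝ => |z.1 - z.2|) hL.abs] at this
        simpa using this

/-- The product coupling has finite cost. Without finiteness, `W ≤ cW` with `c < 1` would not give
`W = 0`. -/
theorem wassersteinTwo_ne_top {m : ℝ} {μ ν : Measure ℝ} (hμ : μ ∈ lawsWithMean m)
    (hν : ν ∈ lawsWithMean m) : wassersteinTwo μ ν ≠ ∞ := by
  have := hμ.1
  have := hν.1
  have h1 : (μ.prod ν).map Prod.fst = μ := by simp
  have h2 : (μ.prod ν).map Prod.snd = ν := by simp
  obtain ⟨-, hL, -⟩ := memLp_of_coupling hμ hν h1 h2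
  refine ne_top_of_le_ne_top ?_ (iInf₂_le (μ.prod ν) ⟨h1, h2⟩)
  rw [lintegral_edist_sq_eq hL]
  exact ENNReal.rpow_ne_top_of_nonneg (by norm_num) ENNReal.ofReal_ne_top

theorem sqrt_two_div_lt_one {a : ℝ} (ha : 1 / 2 < a) : √(2 / (1 + 2 * a)) < 1 := by
  rw [Real.sqrt_lt' one_pos, one_pow, div_lt_one (by linarith)]
  linarith

/-- The smoothing map has at most one fixed point among the laws with a given mean. -/
theorem eq_of_smoothingMap_fixed {p : I} {a m : ℝ} (ha : 1 / 2 < a) {μ ν : Measure ℝ}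
    (hμ : μ ∈ lawsWithMean m) (hν : ν ∈ lawsWithMean m) (hμ' : μ = smoothingMap p a μ)
    (hν' : ν = smoothingMap p a ν) : μ = ν := by
  have hle := wassersteinTwo_smoothingMap_le (p := p) (by linarith : 0 < a) hμ hν
  rw [← hμ', ← hν'] at hle
  have hW : wassersteinTwo μ ν = 0 := by
    by_contra h
    have : ENNReal.ofReal √(2 / (1 + 2 * a)) * wassersteinTwo μ ν < 1 * wassersteinTwo μ ν :=
      ENNReal.mul_lt_mul_left h (wassersteinTwo_ne_top hμ hν)
        (by simpa using sqrt_two_div_lt_one ha)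
    rw [one_mul] at this
    exact absurd hle (not_le.2 this)
  have := hμ.1
  have := hν.1
  refine Measure.ext_of_charFun (funext fun t => ?_)
  have h := norm_charFun_sub_charFun_le hμ hν t
  rw [hW, mul_zero, nonpos_iff_eq_zero, ENNReal.ofReal_eq_zero] at h
  exact sub_eq_zero.1 (norm_le_zero_iff.1 h)

/-- Conditioning on `V = v` and `ξ` leaves two independent copies, so the characteristic function
factors. -/
theorem charFun_smoothingMap (p : I) (a : ℝ) (μ : Measure ℝ) [IsProbabilityMeasure μ] (t : ℝ) :
    charFun (smoothingMap p a μ) t = ∫ v in (0 : ℝ)..1, charFun μ (v ^ a * t) *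
      (p * charFun μ ((1 - v) ^ a * t) + (1 - p) * charFun μ (-((1 - v) ^ a * t))) := by
  have hm : Measurable (smoothingCombination a (id : ℝ → ℝ)) :=
    measurable_smoothingCombination a measurable_id
  have hi : Integrable (fun z : ℝ × ℝ × ℝ × ℝ =>
      Complex.exp (t * smoothingCombination a id z * Complex.I)) (smoothingNoise p μ) := by
    refine Integrable.of_bound (by fun_prop) 1 (ae_of_all _ fun z => ?_)
    rw [← Complex.ofReal_mul, Complex.norm_exp_ofReal_mul_I]
  rw [charFun_apply_real, smoothingMap_eq_map, integral_map hm.aemeasurable (by fun_prop),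
    integral_prod _ hi, integral_Icc_eq_integral_Ioc, ← intervalIntegral.integral_of_le zero_le_one]
  refine intervalIntegral.integral_congr fun v _ => ?_
  have hm' : Measurable fun z => smoothingCombination a (id : ℝ → ℝ) (v, z) :=
    hm.comp measurable_prodMk_left
  have hi' : Integrable (fun z : ℝ × ℝ × ℝ =>
      Complex.exp (t * smoothingCombination a id (v, z) * Complex.I))
      ((bernoulliMeasure (1 : ℝ) 0 p).prod (μ.prod μ)) := by
    refine Integrable.of_bound (Complex.measurable_exp.comp (((Complex.measurable_ofReal.comp
      hm').const_mul (t : ℂ)).mul_const Complex.I)).aestronglyMeasurable 1 (ae_of_all _ fun z => ?_)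
    rw [← Complex.ofReal_mul, Complex.norm_exp_ofReal_mul_I]
  rw [integral_prod _ hi', integral_bernoulliMeasure]
  have key (b : ℝ) : ∫ y : ℝ × ℝ, Complex.exp (t * smoothingCombination a id (v, b, y) *
      Complex.I) ∂(μ.prod μ) = charFun μ (v ^ a * t) *
        charFun μ ((2 * b - 1) * ((1 - v) ^ a * t)) := by
    rw [charFun_apply_real, charFun_apply_real, ← integral_prod_mul]
    refine integral_congr_ae (ae_of_all _ fun y => ?_)
    simp only [smoothingCombination, id]
    rw [← Complex.exp_add]
    push_cast
    ring_nf
  rw [key, key, Complex.real_smul, Complex.real_smul]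
  norm_num
  ring

/-! ### The elephant random walk -/

theorem ae_bernoulliMeasure {α : Type*} [MeasurableSpace α] [MeasurableSingletonClass α]
    (x y : α) (p : I) : ∀ᵐ z ∂bernoulliMeasure x y p, z = x ∨ z = y := by
  rw [ae_iff]
  have hs : MeasurableSet {z | ¬(z = x ∨ z = y)} :=
    ((measurableSet_singleton x).union (measurableSet_singleton y)).compl
  exact bernoulliMeasure_apply_of_notMem_of_notMem p hs (by simp) (by simp)

theorem walkPosition_succ {Ω : Type*} (X : ℕ → Ω → ℝ) (n : ℕ) (ω : Ω) :
    walkPosition X (n + 1) ω = walkPosition X n ω + X (n + 1) ω :=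
  Finset.sum_Icc_succ_top (by omega) _

namespace IsElephantWalk

variable {Ω : Type*} [MeasurableSpace Ω] {P : Measure Ω} {p q : I} {X : ℕ → Ω → ℝ}

theorem ae_eq_one_or_neg_one (hX : IsElephantWalk p q X P) (n : ℕ) (hn : 1 ≤ n) :
    ∀ᵐ ω ∂P, X n ω = 1 ∨ X n ω = -1 := by
  induction n using Nat.strong_induction_on with
  | _ n ih =>
    obtain rfl | ⟨m, hm, rfl⟩ : n = 1 ∨ ∃ m, 1 ≤ m ∧ n = m + 1 := by
      rcases Nat.lt_or_ge 1 n with h | h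
      · exact Or.inr ⟨n - 1, by omega, by omega⟩
      · exact Or.inl (by omega)
    · refine (hX.first_step.ae_iff (p := fun x => x = 1 ∨ x = -1) ?_).2 (ae_bernoulliMeasure _ _ _)
      exact measurableSet_setOfPred.1
        ((measurableSet_singleton (1 : ℝ)).union (measurableSet_singleton (-1)))
    · obtain ⟨K, ξ, hKm, hξm, hK, hξ, -, -, hstep⟩ := hX.next_step m hm
      have hK' : ∀ᵐ ω ∂P, K ω ∈ Set.Icc 1 m := by
        refine (hK.ae_iff (p := fun k => k ∈ Set.Icc 1 m) (by fun_prop)).2 ?_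
        exact ae_cond_mem (measurableSet_Icc)
      have hξ' : ∀ᵐ ω ∂P, ξ ω = 1 ∨ ξ ω = 0 := by
        refine (hξ.ae_iff (p := fun x => x = 1 ∨ x = 0) ?_).2 (ae_bernoulliMeasure _ _ _)
        exact measurableSet_setOfPred.1
          ((measurableSet_singleton (1 : ℝ)).union (measurableSet_singleton 0))
      have hall : ∀ᵐ ω ∂P, ∀ k ∈ Set.Icc 1 m, X k ω = 1 ∨ X k ω = -1 := by
        rw [ae_all_iff]
        intro k
        by_cases hk : k ∈ Set.Icc 1 m
        · filter_upwards [ih k (by have := hk.2; omega) hk.1] with ω h _ using h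
        · exact ae_of_all _ fun ω h => absurd h hk
      filter_upwards [hK', hξ', hall, hstep] with ω h1 h2 h3 h4
      rw [h4]
      rcases h2 with h2 | h2 <;> rcases h3 _ h1 with h3 | h3 <;> rw [h2, h3] <;> norm_num

theorem ae_abs_le_one (hX : IsElephantWalk p q X P) (n : ℕ) (hn : 1 ≤ n) :
    ∀ᵐ ω ∂P, |X n ω| ≤ 1 := by
  filter_upwards [hX.ae_eq_one_or_neg_one n hn] with ω h
  rcases h with h | h <;> simp [h]

theorem measurable_walkPosition (hX : IsElephantWalk p q X P) (n : ℕ) :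
    Measurable (walkPosition X n) :=
  Finset.measurable_fun_sum _ fun k hk => hX.measurable k (Finset.mem_Icc.1 hk).1

theorem ae_abs_walkPosition_le (hX : IsElephantWalk p q X P) (n : ℕ) :
    ∀ᵐ ω ∂P, |walkPosition X n ω| ≤ n := by
  have hall : ∀ᵐ ω ∂P, ∀ k ∈ Finset.Icc 1 n, |X k ω| ≤ 1 :=
    (Finset.eventually_all _).2 fun k hk => hX.ae_abs_le_one k (Finset.mem_Icc.1 hk).1
  filter_upwards [hall] with ω h
  refine (Finset.abs_sum_le_sum_abs _ _).trans ((Finset.sum_le_sum h).trans ?_)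
  simp

variable [IsProbabilityMeasure P]

/-- Given the past, the next step has mean `(2 * p - 1) * S_n / n`. -/
theorem integral_step_mul {𝕜 : Type*} [RCLike 𝕜] (hX : IsElephantWalk p q X P) {n : ℕ}
    (hn : 1 ≤ n) {g : (Finset.Icc 1 n → ℝ) → 𝕜} (hg : Measurable g) {C : ℝ}
    (hgC : ∀ᵐ ω ∂P, ‖g fun i => X i ω‖ ≤ C) :
    ∫ ω, (X (n + 1) ω : 𝕜) * g (fun i => X i ω) ∂P =
      ((2 * p - 1) / n : ℝ) * ∫ ω, (walkPosition X n ω : 𝕜) * g (fun i => X i ω) ∂P := by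
  obtain ⟨K, ξ, hKm, hξm, hK, hξ, hKξ, hind, hstep⟩ := hX.next_step n hn
  have hT : Measurable fun ω (i : Finset.Icc 1 n) => X i ω :=
    measurable_pi_lambda _ fun i => hX.measurable _ (Finset.mem_Icc.1 i.2).1
  have hK' : ∀ᵐ ω ∂P, K ω ∈ Finset.Icc 1 n := by
    refine (hK.ae_iff (p := fun k => k ∈ Finset.Icc 1 n) (by fun_prop)).2 ?_
    filter_upwards [ae_cond_mem (μ := Measure.count) (measurableSet_Icc (a := 1) (b := n))]
      with k hk using Finset.mem_Icc.2 hk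
  have hξ' : ∀ᵐ ω ∂P, ξ ω = 1 ∨ ξ ω = 0 := by
    refine (hξ.ae_iff (p := fun x => x = 1 ∨ x = 0) ?_).2 (ae_bernoulliMeasure _ _ _)
    exact measurableSet_setOfPred.1
      ((measurableSet_singleton (1 : ℝ)).union (measurableSet_singleton 0))
  have hkm (k : ℕ) : Measurable fun j : ℕ => if j = k then (1 : 𝕜) else 0 :=
    measurable_of_countable _
  have hcoe : Measurable (fun x : ℝ => (x : 𝕜)) := RCLike.continuous_ofReal.measurable
  -- Splitting by the value `k` of `K` replaces the random index by fixed ones: `h k` depends on the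
  -- draw alone and `X k * g` on the past alone, so each summand factors by independence.
  set h : ℕ → ℕ × ℝ → 𝕜 := fun k z => (if z.1 = k then 1 else 0) * ((2 * z.2 - 1 : ℝ) : 𝕜) with hh
  have hhm (k : ℕ) : Measurable (h k) :=
    ((hkm k).comp measurable_fst).mul (hcoe.comp (by fun_prop))
  have hP (k : ℕ) (hk : k ∈ Finset.Icc 1 n) :
      ∫ ω, (if K ω = k then (1 : 𝕜) else 0) ∂P = ((1 / n : ℝ) : 𝕜) := by
    have e : (fun ω => if K ω = k then (1 : 𝕜) else 0) =
        (K ⁻¹' {k}).indicator fun _ => (1 : 𝕜) := by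
      funext ω
      by_cases hkω : K ω = k <;> simp [hkω]
    have e2 : P (K ⁻¹' {k}) = uniformOn (Set.Icc 1 n) {k} := by
      rw [← hK.map_eq, Measure.map_apply hKm (measurableSet_singleton k)]
    have e3 : uniformOn (Set.Icc 1 n) {k} = 1 / n := by
      have := uniformOn_apply_finset (s := Finset.Icc 1 n) (t := {k})
      rw [Finset.inter_singleton_of_mem hk] at this
      simpa using this
    rw [e, integral_indicator_const _ (hKm (measurableSet_singleton k)), measureReal_def, e2, e3]
    rw [RCLike.real_smul_eq_coe_mul]
    simp
  have hQ : ∫ ω, ((2 * ξ ω - 1 : ℝ) : 𝕜) ∂P = ((2 * p - 1 : ℝ) : 𝕜) := by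
    rw [integral_ofReal]
    congr 1
    have := hξ.integral_comp (f := fun x => 2 * x - 1) (by fun_prop)
    rw [integral_bernoulliMeasure] at this
    refine this.trans ?_
    simp only [smul_eq_mul]
    ring
  have hE (k : ℕ) (hk : k ∈ Finset.Icc 1 n) :
      ∫ ω, h k (K ω, ξ ω) ∂P = (((2 * p - 1) / n : ℝ) : 𝕜) := by
    rw [hKξ.integral_fun_comp_mul_comp (f := fun j => if j = k then (1 : 𝕜) else 0)
      (g := fun x => ((2 * x - 1 : ℝ) : 𝕜)) hKm.aemeasurable hξm.aemeasurable
      (hkm k).aestronglyMeasurable (hcoe.comp (by fun_prop)).aestronglyMeasurable, hP k hk, hQ,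
      ← RCLike.ofReal_mul]
    congr 1
    ring
  have hgm : Measurable fun ω => g fun i => X i ω := hg.comp hT
  have hGb (k : ℕ) (hk : k ∈ Finset.Icc 1 n) :
      Integrable (fun ω => (X k ω : 𝕜) * g fun i => X i ω) P := by
    have hk1 := (Finset.mem_Icc.1 hk).1
    refine Integrable.of_bound
      ((hcoe.comp (hX.measurable k hk1)).mul hgm).aestronglyMeasurable C ?_
    filter_upwards [hgC, hX.ae_abs_le_one k hk1] with ω h1 h2
    rw [norm_mul, RCLike.norm_ofReal]
    exact (mul_le_of_le_one_left (norm_nonneg _) h2).trans h1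
  have hfac (k : ℕ) (hk : k ∈ Finset.Icc 1 n) :
      ∫ ω, h k (K ω, ξ ω) * ((X k ω : 𝕜) * g fun i => X i ω) ∂P =
        (((2 * p - 1) / n : ℝ) : 𝕜) * ∫ ω, (X k ω : 𝕜) * g (fun i => X i ω) ∂P := by
    rw [← hE k hk]
    exact hind.integral_fun_comp_mul_comp (f := h k) (g := fun x => ((x ⟨k, hk⟩ : ℝ) : 𝕜) * g x)
      (hKm.prodMk hξm).aemeasurable hT.aemeasurable (hhm k).aestronglyMeasurable
      ((hcoe.comp (measurable_pi_apply _)).mul hg).aestronglyMeasurable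
  have hint (k : ℕ) (hk : k ∈ Finset.Icc 1 n) :
      Integrable (fun ω => h k (K ω, ξ ω) * ((X k ω : 𝕜) * g fun i => X i ω)) P := by
    refine (hGb k hk).bdd_mul (c := 1) ((hhm k).comp (hKm.prodMk hξm)).aestronglyMeasurable ?_
    filter_upwards [hξ'] with ω hω
    simp only [hh]
    rw [norm_mul, RCLike.norm_ofReal]
    rcases hω with hω | hω <;> rw [hω] <;> split_ifs <;> norm_num
  have hdecomp : ∀ᵐ ω ∂P, (X (n + 1) ω : 𝕜) * g (fun i => X i ω) =
      ∑ k ∈ Finset.Icc 1 n, h k (K ω, ξ ω) * ((X k ω : 𝕜) * g fun i => X i ω) := by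
    filter_upwards [hK', hstep] with ω h1 h2
    rw [Finset.sum_eq_single_of_mem (K ω) h1]
    · simp only [hh, h2, if_true, RCLike.ofReal_mul]
      ring
    · intro k _ hk
      simp [hh, hk.symm]
  rw [integral_congr_ae hdecomp, integral_finsetSum _ hint, Finset.sum_congr rfl hfac,
    ← Finset.mul_sum, ← integral_finsetSum _ hGb]
  congr 1
  refine integral_congr_ae (ae_of_all _ fun ω => ?_)
  simp only [walkPosition, RCLike.ofReal_sum, Finset.sum_mul]

end IsElephantWalk

/-! ### The characteristic function of the position -/

open Finset.HasAntidiagonal (antidiagonal mem_antidiagonal) in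
/-- Sequences of functions that solve `(n + 1) f_{n+1} = (n + 1) cos f_n + a sin f_n'` are
compatible with products summed over antidiagonals. -/
theorem sum_antidiagonal_mul_of_recursion {a : ℝ} {f g : ℕ → ℝ → ℂ}
    (hf : ∀ n, Differentiable ℝ (f n)) (hg : ∀ n, Differentiable ℝ (g n))
    (hfr : ∀ (n : ℕ) (t : ℝ), (n + 1 : ℂ) * f (n + 1) t =
      (n + 1) * (Real.cos t * f n t) + a * Real.sin t * deriv (f n) t)
    (hgr : ∀ (n : ℕ) (t : ℝ), (n + 1 : ℂ) * g (n + 1) t =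
      (n + 1) * (Real.cos t * g n t) + a * Real.sin t * deriv (g n) t)
    (h0 : ∀ t, f 1 t = f 0 t * g 0 t) (n : ℕ) (t : ℝ) :
    (n + 1 : ℂ) * f (n + 1) t = ∑ ij ∈ antidiagonal n, f ij.1 t * g ij.2 t := by
  induction n generalizing t with
  | zero => simp [h0]
  | succ n ih =>
    have hn : (n + 1 : ℂ) ≠ 0 := by exact_mod_cast n.succ_ne_zero
    -- The induction hypothesis holds for all `t`, so it can be differentiated.
    have hderiv : (n + 1 : ℂ) * deriv (f (n + 1)) t = ∑ ij ∈ antidiagonal n,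
        (deriv (f ij.1) t * g ij.2 t + f ij.1 t * deriv (g ij.2) t) := by
      have h1 : HasDerivAt (fun s => (n + 1 : ℂ) * f (n + 1) s)
          ((n + 1 : ℂ) * deriv (f (n + 1)) t) t := (hf _ t).hasDerivAt.const_mul _
      have h2 : HasDerivAt (fun s => ∑ ij ∈ antidiagonal n, f ij.1 s * g ij.2 s)
          (∑ ij ∈ antidiagonal n,
            (deriv (f ij.1) t * g ij.2 t + f ij.1 t * deriv (g ij.2) t)) t :=
        HasDerivAt.fun_sum fun ij _ => (hf _ t).hasDerivAt.mul (hg _ t).hasDerivAt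
      rw [← funext ih] at h2
      exact h1.unique h2
    -- Write the weight `n+1` as `i+j` and shift `i` in one sum, `j` in the other; the boundary
    -- terms have weight 0.
    have hshift : (n + 1 : ℂ) * ∑ ij ∈ antidiagonal (n + 1), f ij.1 t * g ij.2 t =
        ∑ ij ∈ antidiagonal n, ((ij.1 + 1) * f (ij.1 + 1) t * g ij.2 t +
          f ij.1 t * ((ij.2 + 1) * g (ij.2 + 1) t)) := by
      have e : (n + 1 : ℂ) * ∑ ij ∈ antidiagonal (n + 1), f ij.1 t * g ij.2 t =
          ∑ ij ∈ antidiagonal (n + 1), (ij.1 : ℂ) * f ij.1 t * g ij.2 t +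
          ∑ ij ∈ antidiagonal (n + 1), f ij.1 t * ((ij.2 : ℂ) * g ij.2 t) := by
        rw [Finset.mul_sum, ← Finset.sum_add_distrib]
        refine Finset.sum_congr rfl fun ij hij => ?_
        have : (ij.1 : ℂ) + ij.2 = n + 1 := by exact_mod_cast mem_antidiagonal.1 hij
        rw [← this]
        ring
      rw [e, Finset.Nat.sum_antidiagonal_succ, Finset.Nat.sum_antidiagonal_succ',
        Finset.sum_add_distrib]
      simp
    refine mul_left_cancel₀ hn ?_
    rw [hshift]
    push_cast
    have e1 : (n + 1 : ℂ) * ((n + 1 + 1) * f (n + 1 + 1) t) =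
        (n + 2) * Real.cos t * ((n + 1) * f (n + 1) t) +
          a * Real.sin t * ((n + 1) * deriv (f (n + 1)) t) := by
      have := hfr (n + 1) t
      push_cast at this
      rw [this]
      push_cast
      ring
    rw [e1, hderiv, ih, Finset.mul_sum, Finset.mul_sum, ← Finset.sum_add_distrib]
    refine Finset.sum_congr rfl fun ij hij => ?_
    -- Since `n+2 = (i+1)+(j+1)`, the cosine terms match, and the sine terms match by the Leibniz
    -- rule.
    have : (n : ℂ) = ij.1 + ij.2 := by exact_mod_cast (mem_antidiagonal.1 hij).symm
    rw [hfr, hgr, this]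
    ring

theorem walkPosition_eq_sum {Ω : Type*} (X : ℕ → Ω → ℝ) (n : ℕ) (ω : Ω) :
    walkPosition X n ω = ∑ i : Finset.Icc 1 n, X i ω :=
  (Finset.sum_coe_sort (Finset.Icc 1 n) fun k => X k ω).symm

namespace IsElephantWalk

variable {Ω : Type*} [MeasurableSpace Ω] {P : Measure Ω} {p q : I} {X : ℕ → Ω → ℝ}
  [IsProbabilityMeasure P]

theorem memLp_walkPosition (hX : IsElephantWalk p q X P) (n : ℕ) (r : ℝ≥0∞) :
    MemLp (walkPosition X n) r P :=
  MemLp.of_bound (hX.measurable_walkPosition n).aestronglyMeasurable n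
    (hX.ae_abs_walkPosition_le n)

omit [IsProbabilityMeasure P] in
theorem charFun_walkPosition (hX : IsElephantWalk p q X P) (n : ℕ) (t : ℝ) :
    charFun (P.map (walkPosition X n)) t =
      ∫ ω, Complex.exp (t * walkPosition X n ω * Complex.I) ∂P := by
  rw [charFun_apply_real, integral_map (hX.measurable_walkPosition n).aemeasurable (by fun_prop)]

theorem isProbabilityMeasure_map_walkPosition (hX : IsElephantWalk p q X P) (n : ℕ) :
    IsProbabilityMeasure (P.map (walkPosition X n)) :=
  Measure.isProbabilityMeasure_map (hX.measurable_walkPosition n).aemeasurable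

theorem memLp_id_map_walkPosition (hX : IsElephantWalk p q X P) (n : ℕ) (r : ℝ≥0∞) :
    MemLp id r (P.map (walkPosition X n)) :=
  (memLp_map_measure_iff (by fun_prop) (hX.measurable_walkPosition n).aemeasurable).2
    (hX.memLp_walkPosition n r)

theorem differentiable_charFun_walkPosition (hX : IsElephantWalk p q X P) (n : ℕ) :
    Differentiable ℝ (charFun (P.map (walkPosition X n))) := by
  have := hX.isProbabilityMeasure_map_walkPosition n
  exact (contDiff_charFun (n := 1) (hX.memLp_id_map_walkPosition n _)).differentiable (by simp)

theorem deriv_charFun_walkPosition (hX : IsElephantWalk p q X P) (n : ℕ) (t : ℝ) :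
    deriv (charFun (P.map (walkPosition X n))) t = Complex.I *
      ∫ ω, (walkPosition X n ω : ℂ) * Complex.exp (t * walkPosition X n ω * Complex.I) ∂P := by
  have := hX.isProbabilityMeasure_map_walkPosition n
  rw [← iteratedDeriv_one, iteratedDeriv_charFun (hX.memLp_id_map_walkPosition n _),
    integral_map (hX.measurable_walkPosition n).aemeasurable (by fun_prop)]
  simp

/-- As `X_{n+1} = ±1`, `e^(itX) = cos t + i X sin t`. Given the past, `X_{n+1}` has mean `(2p-1) S_n
/ n`, and `i E[S_n e^(itS_n)]` is the derivative of the characteristic function. -/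
theorem charFun_walkPosition_succ (hX : IsElephantWalk p q X P) {n : ℕ} (hn : 1 ≤ n) (t : ℝ) :
    (n : ℂ) * charFun (P.map (walkPosition X (n + 1))) t =
      n * (Real.cos t * charFun (P.map (walkPosition X n)) t) +
        ((2 * p - 1 : ℝ) : ℂ) * Real.sin t * deriv (charFun (P.map (walkPosition X n))) t := by
  have hn0 : (n : ℂ) ≠ 0 := by exact_mod_cast (by omega : n ≠ 0)
  set E : Ω → ℂ := fun ω => Complex.exp (t * walkPosition X n ω * Complex.I) with hE
  have hEn (ω : Ω) : ‖E ω‖ = 1 := by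
    simp only [hE]
    rw [← Complex.ofReal_mul, Complex.norm_exp_ofReal_mul_I]
  have hSm := hX.measurable_walkPosition n
  have hXm := hX.measurable (n + 1) (by omega)
  have hEm : Measurable E := by fun_prop
  have hEi : Integrable E P :=
    Integrable.of_bound hEm.aestronglyMeasurable 1 (ae_of_all _ fun ω => (hEn ω).le)
  have hXi : Integrable (fun ω => (X (n + 1) ω : ℂ) * E ω) P := by
    refine Integrable.of_bound (by fun_prop) 1 ?_
    filter_upwards [hX.ae_abs_le_one (n + 1) (by omega)] with ω h
    rwa [norm_mul, hEn, mul_one, Complex.norm_real]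
  have hstep : ∫ ω, (X (n + 1) ω : ℂ) * E ω ∂P =
      (((2 * p - 1) / n : ℝ) : ℂ) * ∫ ω, (walkPosition X n ω : ℂ) * E ω ∂P := by
    have := hX.integral_step_mul (𝕜 := ℂ) hn
      (g := fun x => Complex.exp (t * (∑ i, x i : ℝ) * Complex.I)) (by fun_prop) (C := 1)
      (ae_of_all _ fun ω => by rw [← Complex.ofReal_mul, Complex.norm_exp_ofReal_mul_I])
    simp only [← walkPosition_eq_sum] at this
    exact this
  have hpt : ∀ᵐ ω ∂P, Complex.exp (t * walkPosition X (n + 1) ω * Complex.I) =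
      Real.cos t * E ω + Complex.I * Real.sin t * ((X (n + 1) ω : ℂ) * E ω) := by
    filter_upwards [hX.ae_eq_one_or_neg_one (n + 1) (by omega)] with ω h
    have e : Complex.exp (t * X (n + 1) ω * Complex.I) =
        Real.cos t + Complex.I * Real.sin t * X (n + 1) ω := by
      rcases h with h | h <;> rw [h] <;> push_cast
      · rw [mul_one, Complex.exp_mul_I]
        ring
      · rw [mul_neg, mul_one, Complex.exp_mul_I, Complex.cos_neg, Complex.sin_neg]
        ring
    rw [walkPosition_succ]
    push_cast
    rw [mul_add, add_mul, Complex.exp_add, e]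
    simp only [hE]
    push_cast
    ring
  have h0 : charFun (P.map (walkPosition X n)) t = ∫ ω, E ω ∂P := hX.charFun_walkPosition n t
  have h1 : deriv (charFun (P.map (walkPosition X n))) t =
      Complex.I * ∫ ω, (walkPosition X n ω : ℂ) * E ω ∂P := hX.deriv_charFun_walkPosition n t
  rw [h0, h1, hX.charFun_walkPosition, integral_congr_ae hpt, integral_add (hEi.const_mul _)
    (hXi.const_mul _), integral_const_mul, integral_const_mul, hstep]
  push_cast
  field_simp

omit [IsProbabilityMeasure P] in
theorem ae_walkPosition_one (hX : IsElephantWalk p 1 X P) : ∀ᵐ ω ∂P, walkPosition X 1 ω = 1 := by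
  have : ∀ᵐ ω ∂P, X 1 ω = 1 := by
    refine (hX.first_step.ae_iff (p := fun x => x = 1)
      (measurableSet_setOfPred.1 (measurableSet_singleton (1 : ℝ)))).2 ?_
    rw [bernoulliMeasure_one, ae_dirac_eq]
    rfl
  filter_upwards [this] with ω h
  simpa [walkPosition] using h

theorem charFun_walkPosition_one (hX : IsElephantWalk p 1 X P) (t : ℝ) :
    charFun (P.map (walkPosition X 1)) t = Complex.exp (t * Complex.I) := by
  rw [hX.charFun_walkPosition]
  have : ∀ᵐ ω ∂P, Complex.exp (t * walkPosition X 1 ω * Complex.I) =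
      Complex.exp (t * Complex.I) := by
    filter_upwards [hX.ae_walkPosition_one] with ω h
    rw [h, Complex.ofReal_one, mul_one]
  rw [integral_congr_ae this]
  simp

/-- Decomposition of the walk at time `n + 1` into two independent walks whose lengths are
`k` and `n + 1 - k` with `k` uniform on `{1, …, n}`. -/
theorem charFun_walkPosition_split (hX : IsElephantWalk p 1 X P) (n : ℕ) (t : ℝ) :
    (n : ℂ) * charFun (P.map (walkPosition X (n + 1))) t =
      ∑ k ∈ Finset.range n, charFun (P.map (walkPosition X (k + 1))) t *
        (p * charFun (P.map (walkPosition X (n - k))) t +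
          (1 - p) * charFun (P.map (walkPosition X (n - k))) (-t)) := by
  obtain _ | n := n
  · simp
  -- `f n` belongs to `S_{n+1}`, so that `f 0` describes the first step.
  set f : ℕ → ℝ → ℂ := fun n => charFun (P.map (walkPosition X (n + 1))) with hf
  have hfd (n : ℕ) : Differentiable ℝ (f n) := hX.differentiable_charFun_walkPosition _
  have hgd (n : ℕ) (t : ℝ) : HasDerivAt (fun t => (p : ℂ) * f n t + (1 - p) * f n (-t))
      (p * deriv (f n) t + (1 - p) * -deriv (f n) (-t)) t := by
    have h1 := (hfd n t).hasDerivAt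
    have h2 : HasDerivAt (fun s => f n (-s)) (-deriv (f n) (-t)) t := by
      have := (hfd n (-t)).hasDerivAt.scomp t (hasDerivAt_neg t)
      rw [neg_one_smul] at this
      exact this
    exact (h1.const_mul _).add (h2.const_mul _)
  have hfr (n : ℕ) (t : ℝ) : (n + 1 : ℂ) * f (n + 1) t = (n + 1) * (Real.cos t * f n t) +
      ((2 * p - 1 : ℝ) : ℂ) * Real.sin t * deriv (f n) t := by
    have := hX.charFun_walkPosition_succ (n := n + 1) (by omega) t
    push_cast at this ⊢
    exact this
  have key := sum_antidiagonal_mul_of_recursion (a := 2 * p - 1) (f := f)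
    (g := fun n t => (p : ℂ) * f n t + (1 - p) * f n (-t)) hfd
    (fun n t => (hgd n t).differentiableAt) hfr (fun n t => by
      -- The recursion is invariant under `t ↦ -t`, because the sine and the derivative both change
      -- sign; hence the mixture of `f` and its reflection solves it too.
      have h1 := hfr n t
      have h2 := hfr n (-t)
      rw [Real.cos_neg, Real.sin_neg] at h2
      rw [(hgd n t).deriv, mul_add, mul_left_comm, h1, mul_left_comm _ (1 - (p : ℂ)), h2]
      push_cast
      ring) (fun t => by
      -- Starting value: `cos t + i(2p-1) sin t = p e^(it) + (1-p) e^(-it)`.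
      have h1 := hfr 0 t
      have h2 (s : ℝ) : f 0 s = Complex.exp (s * Complex.I) := hX.charFun_walkPosition_one s
      have h3 : deriv (f 0) t = Complex.exp (t * Complex.I) * Complex.I := by
        rw [funext h2]
        have : HasDerivAt (fun s : ℝ => (s : ℂ) * Complex.I) Complex.I t := by
          simpa using (Complex.ofRealCLM.hasDerivAt (x := t)).mul_const Complex.I
        exact this.cexp.deriv
      rw [h3] at h1
      simp only [Nat.cast_zero, zero_add, one_mul] at h1
      rw [h1]
      simp only [h2]
      push_cast
      rw [neg_mul, Complex.exp_neg]
      have h4 : (Complex.exp (t * Complex.I))⁻¹ = Complex.cos t - Complex.sin t * Complex.I := by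
        rw [← Complex.exp_neg, ← neg_mul, Complex.exp_mul_I, Complex.cos_neg, Complex.sin_neg]
        ring
      rw [h4, Complex.exp_mul_I]
      ring) n t
  push_cast
  rw [key, Finset.Nat.sum_antidiagonal_eq_sum_range_succ_mk]
  refine Finset.sum_congr rfl fun k hk => ?_
  have : n + 1 - k = n - k + 1 := by
    have := Finset.mem_range.1 hk
    omega
  simp only [hf, this]

end IsElephantWalk

/-! ### Almost sure convergence -/

/-- The normalising constants `∏_{k < n} (1 + a / (k + 1))` of the martingale of the walk. -/
noncomputable def walkNormalizer (a : ℝ) (n : ℕ) : ℝ :=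
  ∏ k ∈ Finset.range n, (1 + a / (k + 1))

theorem walkNormalizer_pos {a : ℝ} (ha : 0 < a) (n : ℕ) : 0 < walkNormalizer a n :=
  Finset.prod_pos fun k _ => by positivity

theorem walkNormalizer_succ (a : ℝ) (n : ℕ) :
    walkNormalizer a (n + 1) = walkNormalizer a n * (1 + a / (n + 1)) :=
  Finset.prod_range_succ _ _

theorem prod_range_add_eq {a : ℝ} (n : ℕ) :
    ∏ j ∈ Finset.range (n + 2), (a + j) =
      a * (a + n + 1) * (Nat.factorial n * walkNormalizer a n) := by
  have h (n : ℕ) : ∏ j ∈ Finset.range (n + 1), (a + j) =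
      a * (Nat.factorial n * walkNormalizer a n) := by
    induction n with
    | zero => simp [walkNormalizer]
    | succ n ih =>
      rw [Finset.prod_range_succ, ih, walkNormalizer_succ, Nat.factorial_succ]
      have : (n + 1 : ℝ) ≠ 0 := by positivity
      push_cast
      field_simp
      ring
  rw [Finset.prod_range_succ, h]
  push_cast
  ring

/-- Euler's limit formula for `Γ(a)`, multiplied by `a` and inverted. -/
theorem tendsto_walkNormalizer_div_rpow {a : ℝ} (ha : 0 < a) :
    Tendsto (fun n : ℕ => walkNormalizer a n / ((n + 1 : ℕ) : ℝ) ^ a) atTop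
      (𝓝 (1 / Real.Gamma (1 + a))) := by
  have h1 : Tendsto (fun n : ℕ => Real.GammaSeq a (n + 1) * (a * (1 + a / ((n + 1 : ℕ) : ℝ))))
      atTop (𝓝 (Real.Gamma a * (a * (1 + 0)))) := by
    refine ((tendsto_add_atTop_iff_nat 1).2 (Real.GammaSeq_tendsto_Gamma a)).mul
      (tendsto_const_nhds.mul (tendsto_const_nhds.add ?_))
    exact (tendsto_add_atTop_iff_nat 1).2 (tendsto_const_div_atTop_nhds_zero_nat a)
  have e : Real.Gamma a * (a * (1 + 0)) = Real.Gamma (1 + a) := by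
    rw [add_comm 1 a, Real.Gamma_add_one ha.ne']
    ring
  rw [e] at h1
  have h2 := h1.inv₀ (Real.Gamma_pos_of_pos (by positivity)).ne'
  rw [← one_div] at h2
  refine h2.congr fun n => ?_
  have hA := walkNormalizer_pos ha n
  have hr : 0 < ((n + 1 : ℕ) : ℝ) ^ a := by positivity
  have hf : (0 : ℝ) < Nat.factorial n := by positivity
  have hn : (0 : ℝ) < n + 1 := by positivity
  rw [Real.GammaSeq, prod_range_add_eq, Nat.factorial_succ]
  push_cast at hr ⊢
  field_simp
  ring

namespace IsElephantWalk

variable {Ω : Type*} [MeasurableSpace Ω] {P : Measure Ω} {p q : I} {X : ℕ → Ω → ℝ}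
  {a : ℝ}

/-- The information carried by the first `n + 1` steps of the walk. -/
def pastFiltration (hX : IsElephantWalk p q X P) : Filtration ℕ ‹MeasurableSpace Ω› where
  seq n := MeasurableSpace.comap (fun ω (i : Finset.Icc 1 (n + 1)) => X i ω) inferInstance
  mono' m n hmn := by
    rintro _ ⟨B, hB, rfl⟩
    have hi (i : Finset.Icc 1 (m + 1)) : (i : ℕ) ∈ Finset.Icc 1 (n + 1) :=
      Finset.Icc_subset_Icc_right (by omega) i.2
    have hproj : Measurable fun (x : Finset.Icc 1 (n + 1) → ℝ) (i : Finset.Icc 1 (m + 1)) =>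
        x ⟨i, hi i⟩ := by fun_prop
    exact ⟨_, hproj hB, rfl⟩
  le' n := (measurable_pi_lambda _ fun i => hX.measurable _ (Finset.mem_Icc.1 i.2).1).comap_le

/-- The walk at time `n + 1` divided by the normalising constant. -/
noncomputable def normalizedWalk (a : ℝ) (X : ℕ → Ω → ℝ) (n : ℕ) (ω : Ω) : ℝ :=
  walkPosition X (n + 1) ω / walkNormalizer a n

variable [IsProbabilityMeasure P]

theorem integrable_normalizedWalk (hX : IsElephantWalk p q X P) (n : ℕ) :
    Integrable (normalizedWalk a X n) P :=
  ((hX.memLp_walkPosition (n + 1) 1).integrable le_rfl).div_const _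

theorem martingale_normalizedWalk (hX : IsElephantWalk p q X P) (hap : a = 2 * (p : ℝ) - 1)
    (ha : 0 < a) : Martingale (normalizedWalk a X) hX.pastFiltration P := by
  have hmeas (n : ℕ) : Measurable[hX.pastFiltration n] (normalizedWalk a X n) := by
    have h1 : Measurable fun x : Finset.Icc 1 (n + 1) → ℝ => (∑ i, x i) / walkNormalizer a n := by
      fun_prop
    have h2 := h1.comp (comap_measurable fun ω (i : Finset.Icc 1 (n + 1)) => X i ω)
    convert! h2 using 1
    funext ω
    simp only [normalizedWalk, walkPosition_eq_sum, Function.comp_apply]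
  refine martingale_nat (fun n => (hmeas n).stronglyMeasurable)
    (fun n => hX.integrable_normalizedWalk n) fun n => ?_
  refine ae_eq_condExp_of_forall_setIntegral_eq (hX.pastFiltration.le n)
    (hX.integrable_normalizedWalk _) (fun s _ _ => (hX.integrable_normalizedWalk _).integrableOn)
    ?_ (hmeas n).aestronglyMeasurable
  rintro s hs -
  have hs' := hX.pastFiltration.le n s hs
  obtain ⟨B, hB, rfl⟩ := hs
  -- Testing against indicators of past events reduces the martingale property to
  -- `integral_step_mul`.
  set g : (Finset.Icc 1 (n + 1) → ℝ) → ℝ := B.indicator fun _ => 1 with hg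
  have hind (f : Ω → ℝ) : ∫ ω in (fun ω (i : Finset.Icc 1 (n + 1)) => X i ω) ⁻¹' B, f ω ∂P =
      ∫ ω, f ω * g (fun i => X i ω) ∂P := by
    rw [← integral_indicator hs']
    refine integral_congr_ae (ae_of_all _ fun ω => ?_)
    by_cases h : (fun i : Finset.Icc 1 (n + 1) => X i ω) ∈ B <;> simp [hg, h]
  have hgm : Measurable g := measurable_const.indicator hB
  have hg1 (x) : ‖g x‖ ≤ 1 := by
    by_cases h : x ∈ B <;> simp [hg, h]
  have hT : Measurable fun ω (i : Finset.Icc 1 (n + 1)) => X i ω :=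
    measurable_pi_lambda _ fun i => hX.measurable _ (Finset.mem_Icc.1 i.2).1
  have hgi (f : Ω → ℝ) (hf : Integrable f P) :
      Integrable (fun ω => f ω * g fun i => X i ω) P :=
    hf.mul_bdd (c := 1) (hgm.comp hT).aestronglyMeasurable (ae_of_all _ fun ω => hg1 _)
  have hstep := hX.integral_step_mul (𝕜 := ℝ) (n := n + 1) (by omega) hgm (C := 1)
    (ae_of_all _ fun ω => hg1 _)
  have hS := hgi _ ((hX.memLp_walkPosition (n + 1) 1).integrable le_rfl)
  have hXi : Integrable (X (n + 2)) P := by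
    refine Integrable.of_bound (hX.measurable _ (by omega)).aestronglyMeasurable 1 ?_
    filter_upwards [hX.ae_abs_le_one (n + 2) (by omega)] with ω h using h
  have hA := (walkNormalizer_pos ha n).ne'
  have hA' := (walkNormalizer_pos ha (n + 1)).ne'
  rw [hind, hind]
  simp only [normalizedWalk, walkPosition_succ X (n + 1), div_mul_eq_mul_div, integral_div, add_mul]
  rw [integral_add hS (hgi _ hXi)]
  simp only [RCLike.ofReal_real_eq_id, id] at hstep
  rw [hstep, ← hap, walkNormalizer_succ]
  rw [walkNormalizer_succ] at hA'
  have hn : (0 : ℝ) < n + 1 := by positivity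
  push_cast
  field_simp

theorem integral_walkPosition_sq_succ (hX : IsElephantWalk p q X P) {n : ℕ} (hn : 1 ≤ n) :
    ∫ ω, walkPosition X (n + 1) ω ^ 2 ∂P =
      (1 + 2 * (2 * p - 1) / n) * ∫ ω, walkPosition X n ω ^ 2 ∂P + 1 := by
  have hXm := hX.measurable (n + 1) (by omega)
  have hstep := hX.integral_step_mul (𝕜 := ℝ) hn (g := fun x => ∑ i, x i) (by fun_prop) (C := n)
    (by filter_upwards [hX.ae_abs_walkPosition_le n] with ω h; rwa [← walkPosition_eq_sum])
  simp only [RCLike.ofReal_real_eq_id, id, ← walkPosition_eq_sum] at hstep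
  have hpt : ∀ᵐ ω ∂P, walkPosition X (n + 1) ω ^ 2 =
      walkPosition X n ω ^ 2 + 2 * (X (n + 1) ω * walkPosition X n ω) + 1 := by
    filter_upwards [hX.ae_eq_one_or_neg_one (n + 1) (by omega)] with ω h
    rw [walkPosition_succ]
    rcases h with h | h <;> rw [h] <;> ring
  have i1 : Integrable (fun ω => walkPosition X n ω ^ 2) P :=
    (hX.memLp_walkPosition n 2).integrable_sq
  have i2 : Integrable (fun ω => X (n + 1) ω * walkPosition X n ω) P := by
    refine ((hX.memLp_walkPosition n 1).integrable le_rfl).bdd_mul (c := 1)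
      hXm.aestronglyMeasurable ?_
    filter_upwards [hX.ae_abs_le_one (n + 1) (by omega)] with ω h using h
  have e : ∫ ω, walkPosition X n ω ^ 2 + 2 * (X (n + 1) ω * walkPosition X n ω) ∂P =
      ∫ ω, walkPosition X n ω ^ 2 ∂P + ∫ ω, 2 * (X (n + 1) ω * walkPosition X n ω) ∂P :=
    integral_add i1 (i2.const_mul 2)
  refine (integral_congr_ae hpt).trans
    ((integral_add (i1.add (i2.const_mul 2)) (integrable_const _)).trans ?_)
  simp only [Pi.add_apply]
  rw [e, integral_const_mul, hstep]
  simp_rw [← pow_two]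
  simp
  ring

theorem integral_walkPosition_one_sq (hX : IsElephantWalk p q X P) :
    ∫ ω, walkPosition X 1 ω ^ 2 ∂P = 1 := by
  have : ∀ᵐ ω ∂P, walkPosition X 1 ω ^ 2 = 1 := by
    filter_upwards [hX.ae_eq_one_or_neg_one 1 le_rfl] with ω h
    rcases h with h | h <;> simp [walkPosition, h]
  rw [integral_congr_ae this]
  simp

theorem integral_walkPosition_sq_le (hX : IsElephantWalk p q X P) (hap : a = 2 * (p : ℝ) - 1)
    (ha : 1 / 2 < a) (n : ℕ) :
    ∫ ω, walkPosition X (n + 1) ω ^ 2 ∂P ≤ (1 + 1 / (2 * a - 1)) * walkNormalizer a n ^ 2 := by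
  have h0 : 0 < 2 * a - 1 := by linarith
  -- The second moment solves `y_{n+1} = (1+2a/n) y_n + 1`, with particular solution `-n/(2a-1)`.
  -- Subtracting it leaves a homogeneous recursion, controlled by `1+2a/n ≤ (1+a/n)^2`.
  suffices h : ∫ ω, walkPosition X (n + 1) ω ^ 2 ∂P + (n + 1) / (2 * a - 1) ≤
      (1 + 1 / (2 * a - 1)) * walkNormalizer a n ^ 2 by
    have : 0 ≤ (n + 1) / (2 * a - 1) := by positivity
    linarith
  induction n with
  | zero => simp [hX.integral_walkPosition_one_sq, walkNormalizer]
  | succ n ih =>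
    have hn : (0 : ℝ) < n + 1 := by positivity
    rw [hX.integral_walkPosition_sq_succ (by omega), ← hap, walkNormalizer_succ]
    push_cast
    calc (1 + 2 * a / (n + 1)) * ∫ ω, walkPosition X (n + 1) ω ^ 2 ∂P + 1 +
          (n + 1 + 1) / (2 * a - 1)
        = (1 + 2 * a / (n + 1)) *
          (∫ ω, walkPosition X (n + 1) ω ^ 2 ∂P + (n + 1) / (2 * a - 1)) := by
          field_simp
          ring
      _ ≤ (1 + a / (n + 1)) ^ 2 * ((1 + 1 / (2 * a - 1)) * walkNormalizer a n ^ 2) := by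
          refine mul_le_mul ?_ ih ?_ (sq_nonneg _)
          · have e : (1 + a / (n + 1)) ^ 2 = 1 + 2 * a / (n + 1) + (a / (n + 1)) ^ 2 := by ring
            rw [e]
            linarith [sq_nonneg (a / (n + 1))]
          · exact add_nonneg (integral_nonneg fun _ => sq_nonneg _) (by positivity)
      _ = _ := by ring

theorem eLpNorm_two_normalizedWalk_le (hX : IsElephantWalk p q X P) (hap : a = 2 * (p : ℝ) - 1)
    (ha : 1 / 2 < a) (n : ℕ) :
    eLpNorm (normalizedWalk a X n) 2 P ≤ (√(1 + 1 / (2 * a - 1))).toNNReal := by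
  have h0 : 0 < 2 * a - 1 := by linarith
  have hA := walkNormalizer_pos (by linarith : 0 < a) n
  have hL : MemLp (normalizedWalk a X n) 2 P :=
    (hX.memLp_walkPosition (n + 1) 2).mul_const (walkNormalizer a n)⁻¹
  have h2 : ∫ ω, normalizedWalk a X n ω ^ 2 ∂P ≤ 1 + 1 / (2 * a - 1) := by
    simp only [normalizedWalk, div_pow, integral_div]
    rw [div_le_iff₀ (by positivity)]
    exact hX.integral_walkPosition_sq_le hap ha n
  rw [hL.eLpNorm_eq_integral_rpow_norm (by norm_num) (by norm_num)]
  refine ENNReal.ofReal_le_ofReal ?_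
  rw [Real.sqrt_eq_rpow]
  simp only [ENNReal.toReal_ofNat, Real.rpow_two, Real.norm_eq_abs, sq_abs]
  rw [one_div (2 : ℝ)]
  exact Real.rpow_le_rpow (integral_nonneg fun _ => sq_nonneg _) h2 (by norm_num)

end IsElephantWalk

/-- A sequence that is bounded in `L²` is uniformly integrable. -/
theorem uniformIntegrable_of_eLpNorm_two_le {Ω ι : Type*} [MeasurableSpace Ω] {P : Measure Ω}
    [IsFiniteMeasure P] {f : ι → Ω → ℝ} (hf : ∀ i, AEStronglyMeasurable (f i) P) {R : NNReal}
    (hR : ∀ i, eLpNorm (f i) 2 P ≤ R) : UniformIntegrable f 1 P := by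
  refine uniformIntegrable_of le_rfl ENNReal.one_ne_top hf fun ε hε => ?_
  -- On `{|f| ≥ C}`, `|f| ≤ f²/C`, so the tail is at most `R²/C ≤ ε`; the added 1 keeps `C`
  -- positive.
  set C : NNReal := (R ^ 2 + 1) / ε.toNNReal with hC
  have hε' : 0 < ε.toNNReal := Real.toNNReal_pos.2 hε
  have hC0 : 0 < C := by positivity
  refine ⟨C, fun i => ?_⟩
  have hsq : ∫⁻ ω, ‖f i ω‖ₑ ^ 2 ∂P ≤ (R : ℝ≥0∞) ^ 2 := by
    have h := hR i
    rw [eLpNorm_eq_lintegral_rpow_enorm_toReal (by norm_num) (by norm_num)] at h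
    simp only [ENNReal.toReal_ofNat, ENNReal.rpow_two] at h
    have h' := ENNReal.rpow_le_rpow (z := 2) h (by norm_num)
    rw [← ENNReal.rpow_mul] at h'
    simpa using h'
  have hpt (ω : Ω) : ‖{x | C ≤ ‖f i x‖₊}.indicator (f i) ω‖ₑ ≤
      (C : ℝ≥0∞)⁻¹ * ‖f i ω‖ₑ ^ 2 := by
    by_cases h : C ≤ ‖f i ω‖₊
    · have hm : ω ∈ {x | C ≤ ‖f i x‖₊} := h
      rw [Set.indicator_of_mem hm, ← ENNReal.div_eq_inv_mul, ENNReal.le_div_iff_mul_le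
        (Or.inl (by exact_mod_cast hC0.ne')) (Or.inl ENNReal.coe_ne_top), pow_two]
      gcongr
      exact_mod_cast h
    · have hm : ω ∉ {x | C ≤ ‖f i x‖₊} := h
      rw [Set.indicator_of_notMem hm]
      simp
  rw [eLpNorm_one_eq_lintegral_enorm]
  calc ∫⁻ ω, ‖{x | C ≤ ‖f i x‖₊}.indicator (f i) ω‖ₑ ∂P
      ≤ ∫⁻ ω, (C : ℝ≥0∞)⁻¹ * ‖f i ω‖ₑ ^ 2 ∂P := lintegral_mono hpt
    _ = (C : ℝ≥0∞)⁻¹ * ∫⁻ ω, ‖f i ω‖ₑ ^ 2 ∂P :=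
        lintegral_const_mul' _ _ (ENNReal.inv_ne_top.2 (by exact_mod_cast hC0.ne'))
    _ ≤ (C : ℝ≥0∞)⁻¹ * (R : ℝ≥0∞) ^ 2 := by gcongr
    _ ≤ ENNReal.ofReal ε := by
        rw [← ENNReal.coe_inv hC0.ne', ← ENNReal.coe_pow, ← ENNReal.coe_mul, ENNReal.ofReal,
          ENNReal.coe_le_coe, hC, inv_div, div_mul_eq_mul_div]
        rw [div_le_iff₀ (by positivity)]
        gcongr
        exact le_self_add

namespace IsElephantWalk

variable {Ω : Type*} [MeasurableSpace Ω] {P : Measure Ω} {p : I} {X : ℕ → Ω → ℝ}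
  {a : ℝ} [IsProbabilityMeasure P]

theorem integral_walkPosition_one (hX : IsElephantWalk p 1 X P) :
    ∫ ω, walkPosition X 1 ω ∂P = 1 := by
  rw [integral_congr_ae hX.ae_walkPosition_one]
  simp

/-- The rescaled walk converges almost surely to a square integrable limit. -/
theorem exists_limit (hX : IsElephantWalk p 1 X P) (hap : a = 2 * (p : ℝ) - 1)
    (ha : 1 / 2 < a) : ∃ L : Ω → ℝ, Measurable L ∧ MemLp L 2 P ∧
      ∫ ω, L ω ∂P = 1 / Real.Gamma (1 + a) ∧
      ∀ᵐ ω ∂P, Tendsto (fun n : ℕ => walkPosition X n ω / (n : ℝ) ^ a) atTop (𝓝 (L ω)) := by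
  have ha0 : 0 < a := by linarith
  have hM := hX.martingale_normalizedWalk hap ha0
  have h2 := hX.eLpNorm_two_normalizedWalk_le hap ha
  have hm (n : ℕ) : AEStronglyMeasurable (normalizedWalk a X n) P :=
    (hX.integrable_normalizedWalk n).aestronglyMeasurable
  have hUI := uniformIntegrable_of_eLpNorm_two_le hm h2
  set M := hX.pastFiltration.limitProcess (normalizedWalk a X) P with hMdef
  have hMm : Measurable M := Filtration.stronglyMeasurable_limit_process'.measurable
  have hML : MemLp M 2 P := hM.submartingale.memLp_limitProcess h2
  have hlim := hM.submartingale.ae_tendsto_limitProcess_of_uniformIntegrable hUI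
  -- Uniform integrability closes the martingale, so `M` has the mean of its initial term `S_1 = 1`.
  have hmean : ∫ ω, M ω ∂P = 1 := by
    have h := hM.ae_eq_condExp_limitProcess hUI 0
    rw [← integral_condExp (hX.pastFiltration.le 0), ← integral_congr_ae h]
    simpa [normalizedWalk, walkNormalizer] using hX.integral_walkPosition_one
  refine ⟨fun ω => M ω * (1 / Real.Gamma (1 + a)), hMm.mul_const _, hML.mul_const _, ?_, ?_⟩
  · rw [integral_mul_const, hmean, one_mul]
  · filter_upwards [hlim] with ω hω
    rw [← tendsto_add_atTop_iff_nat 1]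
    refine (hω.mul (tendsto_walkNormalizer_div_rpow ha0)).congr fun n => ?_
    have := (walkNormalizer_pos ha0 n).ne'
    simp only [normalizedWalk]
    field_simp

end IsElephantWalk

/-! ### The law of the limit -/

/-- An exact integral form of the splitting sum, to which dominated convergence applies. -/
theorem sum_range_eq_integral_floor (n : ℕ) (f : ℕ → ℂ) :
    ∑ k ∈ Finset.range n, f k = (n : ℂ) * ∫ v in (0 : ℝ)..1, f ⌊v * n⌋₊ := by
  have hstep (k : ℕ) : Set.EqOn (fun u : ℝ => f ⌊u⌋₊) (fun _ => f k)
      (Set.Ico (k : ℝ) ((k + 1 : ℕ) : ℝ)) := fun u hu => by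
    have h0 : 0 ≤ u := (Nat.cast_nonneg k).trans hu.1
    have : ⌊u⌋₊ = k := (Nat.floor_eq_iff h0).2 ⟨hu.1, by simpa using hu.2⟩
    simp only [this]
  have hle (k : ℕ) : (k : ℝ) ≤ ((k + 1 : ℕ) : ℝ) := by simp
  -- The floor is constant on `[k, k+1)` while interval integrals use `(k, k+1]`; the endpoint is a
  -- null set.
  have hae (k : ℕ) : ∀ᵐ u : ℝ, u ∈ Set.uIoc (k : ℝ) ((k + 1 : ℕ) : ℝ) → f k = f ⌊u⌋₊ := by
    have hne : ∀ᵐ u : ℝ, u ≠ ((k + 1 : ℕ) : ℝ) := by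
      simp [ae_iff, measure_singleton]
    filter_upwards [hne] with u hu hmem
    rw [Set.uIoc_of_le (hle k)] at hmem
    exact (hstep k ⟨hmem.1.le, lt_of_le_of_ne hmem.2 hu⟩).symm
  have hpiece (k : ℕ) : ∫ u in (k : ℝ)..((k + 1 : ℕ) : ℝ), f ⌊u⌋₊ = f k := by
    rw [← intervalIntegral.integral_congr_ae (hae k), intervalIntegral.integral_const]
    simp
  have hint (k : ℕ) : IntervalIntegrable (fun u : ℝ => f ⌊u⌋₊) volume (k : ℝ)
      ((k + 1 : ℕ) : ℝ) :=
    (intervalIntegrable_const (c := f k)).congr_ae ((ae_restrict_iff' measurableSet_uIoc).2 (hae k))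
  have hsum := intervalIntegral.sum_integral_adjacent_intervals (a := fun k : ℕ => (k : ℝ))
    (n := n) fun k _ => hint k
  rw [Finset.sum_congr rfl fun k _ => hpiece k] at hsum
  rw [hsum]
  have := intervalIntegral.smul_integral_comp_mul_right (a := 0) (b := 1)
    (fun u : ℝ => f ⌊u⌋₊) (n : ℝ)
  rw [zero_mul, one_mul, Complex.real_smul] at this
  push_cast at this ⊢
  exact this.symm

namespace IsElephantWalk

variable {Ω : Type*} [MeasurableSpace Ω] {P : Measure Ω} {p : I} {X : ℕ → Ω → ℝ}
  {a : ℝ} [IsProbabilityMeasure P]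

/-- Write `S_k / n^a = (k/n)^a * (S_k / k^a)`; the condition `r > 0` forces `k → ∞`. Conclude by
bounded convergence. -/
theorem tendsto_charFun_walkPosition (hX : IsElephantWalk p 1 X P) {L : Ω → ℝ}
    (hLm : Measurable L)
    (hL : ∀ᵐ ω ∂P, Tendsto (fun n : ℕ => walkPosition X n ω / (n : ℝ) ^ a) atTop (𝓝 (L ω)))
    {k : ℕ → ℕ} {r : ℝ} (hr : 0 < r)
    (hk : Tendsto (fun n : ℕ => (k n : ℝ) / n) atTop (𝓝 r)) (t : ℝ) :
    Tendsto (fun n : ℕ => charFun (P.map (walkPosition X (k n))) (t / (n : ℝ) ^ a)) atTop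
      (𝓝 (charFun (P.map L) (r ^ a * t))) := by
  have hk' : Tendsto k atTop atTop := by
    rw [← tendsto_natCast_atTop_iff (R := ℝ)]
    refine (hk.pos_mul_atTop hr tendsto_natCast_atTop_atTop).congr' ?_
    filter_upwards [eventually_ne_atTop 0] with n hn
    have : (n : ℝ) ≠ 0 := by exact_mod_cast hn
    field_simp
  rw [charFun_apply_real, integral_map hLm.aemeasurable (by fun_prop)]
  simp only [hX.charFun_walkPosition]
  have hSm (n : ℕ) := hX.measurable_walkPosition n
  refine tendsto_integral_of_dominated_convergence (fun _ => 1) (fun n => ?_)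
    (integrable_const _) (fun n => ae_of_all _ fun ω => ?_) ?_
  · have := hSm (k n)
    fun_prop
  · rw [← Complex.ofReal_mul, Complex.norm_exp_ofReal_mul_I]
  · filter_upwards [hL] with ω hω
    have h1 : Tendsto (fun n : ℕ => t / (n : ℝ) ^ a * walkPosition X (k n) ω) atTop
        (𝓝 (r ^ a * t * L ω)) := by
      have h2 : Tendsto (fun n : ℕ => ((k n : ℝ) / n) ^ a) atTop (𝓝 (r ^ a)) :=
        hk.rpow_const (Or.inl hr.ne')
      refine ((h2.mul_const t).mul (hω.comp hk')).congr' ?_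
      filter_upwards [eventually_ne_atTop 0, hk'.eventually_ne_atTop 0] with n hn hkn
      have hn0 : 0 < (n : ℝ) := by exact_mod_cast Nat.pos_of_ne_zero hn
      have hk0 : 0 < (k n : ℝ) := by exact_mod_cast Nat.pos_of_ne_zero hkn
      rw [Function.comp_apply, Real.div_rpow hk0.le hn0.le]
      have := (Real.rpow_pos_of_pos hk0 a).ne'
      have := (Real.rpow_pos_of_pos hn0 a).ne'
      field_simp
    have hcont : Continuous fun x : ℝ => Complex.exp (x * Complex.I) := by fun_prop
    have h3 := (hcont.tendsto _).comp h1
    refine (h3.congr fun n => ?_).trans (le_of_eq ?_)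
    · rw [Function.comp_apply, Complex.ofReal_mul]
    · rw [Complex.ofReal_mul]

theorem map_limit_eq_smoothingMap (hX : IsElephantWalk p 1 X P) {L : Ω → ℝ}
    (hLm : Measurable L)
    (hL : ∀ᵐ ω ∂P, Tendsto (fun n : ℕ => walkPosition X n ω / (n : ℝ) ^ a) atTop (𝓝 (L ω))) :
    P.map L = smoothingMap p a (P.map L) := by
  have hprob : IsProbabilityMeasure (P.map L) := Measure.isProbabilityMeasure_map hLm.aemeasurable
  have hprob' : IsProbabilityMeasure (smoothingMap p a (P.map L)) := by
    rw [smoothingMap_eq_map]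
    exact Measure.isProbabilityMeasure_map
      (measurable_smoothingCombination a measurable_id).aemeasurable
  have hφ {k : ℕ → ℕ} {r : ℝ} (hr : 0 < r)
      (hk : Tendsto (fun n : ℕ => (k n : ℝ) / n) atTop (𝓝 r)) (t : ℝ) :=
    hX.tendsto_charFun_walkPosition hLm hL hr hk t
  refine Measure.ext_of_charFun (funext fun t => ?_)
  rw [charFun_smoothingMap]
  set φ : ℕ → ℝ → ℂ := fun n => charFun (P.map (walkPosition X n)) with hφdef
  set ψ : ℕ → ℝ → ℂ := fun n s => p * φ n s + (1 - p) * φ n (-s) with hψ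
  have hinv : Tendsto (fun n : ℕ => (1 : ℝ) / n) atTop (𝓝 0) := tendsto_one_div_atTop_nhds_zero_nat
  have hlhs : Tendsto (fun n : ℕ => φ (n + 1) (t / (n : ℝ) ^ a)) atTop
      (𝓝 (charFun (P.map L) t)) := by
    have h := hφ (k := fun n => n + 1) one_pos ?_ t
    · rwa [Real.one_rpow, one_mul] at h
    · have : Tendsto (fun n : ℕ => 1 + (1 : ℝ) / n) atTop (𝓝 1) := by
        simpa using hinv.const_add 1
      refine this.congr' ?_
      filter_upwards [eventually_ne_atTop 0] with n hn
      have : (n : ℝ) ≠ 0 := by exact_mod_cast hn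
      push_cast
      field_simp
  refine tendsto_nhds_unique hlhs ?_
  have hint (n : ℕ) (hn : n ≠ 0) : φ (n + 1) (t / (n : ℝ) ^ a) = ∫ v in (0 : ℝ)..1,
      φ (⌊v * n⌋₊ + 1) (t / (n : ℝ) ^ a) * ψ (n - ⌊v * n⌋₊) (t / (n : ℝ) ^ a) := by
    have h := hX.charFun_walkPosition_split n (t / (n : ℝ) ^ a)
    rw [sum_range_eq_integral_floor n fun k => φ (k + 1) (t / (n : ℝ) ^ a) *
      ψ (n - k) (t / (n : ℝ) ^ a)] at h
    exact mul_left_cancel₀ (by exact_mod_cast hn) h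
  have hb (n : ℕ) (s : ℝ) : ‖φ n s‖ ≤ 1 := by
    have := hX.isProbabilityMeasure_map_walkPosition n
    exact norm_charFun_le_one s
  have hp0 : ‖(p : ℂ)‖ = p := by
    rw [Complex.norm_real, Real.norm_of_nonneg p.2.1]
  have hp1 : ‖(1 - p : ℂ)‖ = 1 - p := by
    rw [← Complex.ofReal_one, ← Complex.ofReal_sub, Complex.norm_real,
      Real.norm_of_nonneg (sub_nonneg.2 p.2.2)]
  have hbψ (n : ℕ) (s : ℝ) : ‖ψ n s‖ ≤ 1 := by
    calc ‖ψ n s‖ ≤ ‖(p : ℂ)‖ * ‖φ n s‖ + ‖(1 - p : ℂ)‖ * ‖φ n (-s)‖ := by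
          simp only [hψ]
          refine (norm_add_le _ _).trans_eq ?_
          rw [norm_mul, norm_mul]
      _ ≤ ‖(p : ℂ)‖ * 1 + ‖(1 - p : ℂ)‖ * 1 := by gcongr <;> exact hb _ _
      _ = 1 := by rw [hp0, hp1]; ring
  have hdct : Tendsto (fun n : ℕ => ∫ v in (0 : ℝ)..1,
      φ (⌊v * n⌋₊ + 1) (t / (n : ℝ) ^ a) * ψ (n - ⌊v * n⌋₊) (t / (n : ℝ) ^ a)) atTop
      (𝓝 (∫ v in (0 : ℝ)..1, charFun (P.map L) (v ^ a * t) *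
        (p * charFun (P.map L) ((1 - v) ^ a * t) +
          (1 - p) * charFun (P.map L) (-((1 - v) ^ a * t))))) := by
    refine intervalIntegral.tendsto_integral_filter_of_dominated_convergence (fun _ => 1)
      (Eventually.of_forall fun n => ?_) (Eventually.of_forall fun n => ae_of_all _ fun v _ => ?_)
      intervalIntegrable_const ?_
    · have h1 : Measurable fun v : ℝ => ⌊v * n⌋₊ :=
        Nat.measurable_floor.comp (measurable_id.mul_const _)
      have h2 : Measurable fun k : ℕ => φ (k + 1) (t / (n : ℝ) ^ a) *
          ψ (n - k) (t / (n : ℝ) ^ a) := measurable_of_countable _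
      exact (h2.comp h1).aestronglyMeasurable
    · rw [norm_mul]
      exact mul_le_one₀ (hb _ _) (norm_nonneg _) (hbψ _ _)
    -- Both endpoints are excluded, so that the lengths of both walks, of order `vn` and `(1-v)n`,
    -- tend to infinity.
    · have hne : ∀ᵐ v : ℝ, v ≠ 1 := by
        simp [ae_iff, measure_singleton]
      filter_upwards [hne] with v hv1 hv
      rw [Set.uIoc_of_le zero_le_one] at hv
      have hv0 : 0 < v := hv.1
      have hv1 : v < 1 := lt_of_le_of_ne hv.2 hv1
      have hfl : Tendsto (fun n : ℕ => (⌊v * n⌋₊ : ℝ) / n) atTop (𝓝 v) :=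
        (tendsto_nat_floor_mul_div_atTop hv0.le).comp tendsto_natCast_atTop_atTop
      have hk1 : Tendsto (fun n : ℕ => ((⌊v * n⌋₊ + 1 : ℕ) : ℝ) / n) atTop (𝓝 v) := by
        have := hfl.add hinv
        rw [add_zero] at this
        refine this.congr fun n => ?_
        push_cast
        ring
      have hk2 : Tendsto (fun n : ℕ => ((n - ⌊v * n⌋₊ : ℕ) : ℝ) / n) atTop (𝓝 (1 - v)) := by
        refine (hfl.const_sub 1).congr' ?_
        filter_upwards [eventually_ne_atTop 0] with n hn
        have hn0 : (n : ℝ) ≠ 0 := by exact_mod_cast hn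
        have hle : ⌊v * n⌋₊ ≤ n := by
          refine Nat.floor_le_of_le ?_
          exact mul_le_of_le_one_left (Nat.cast_nonneg n) hv1.le
        rw [Nat.cast_sub hle, sub_div, div_self hn0]
      have l1 := hφ hv0 hk1 t
      have l2 := hφ (sub_pos.2 hv1) hk2 t
      have l3 := hφ (sub_pos.2 hv1) hk2 (-t)
      simp only [neg_div, mul_neg] at l3
      exact l1.mul ((l2.const_mul _).add (l3.const_mul _))
  refine hdct.congr' ?_
  filter_upwards [eventually_ne_atTop 0] with n hn using (hint n hn).symm

/-- The rescaled walk has a limit whose law is a fixed point of the smoothing map. -/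
theorem exists_limit_fixed (hX : IsElephantWalk p 1 X P) (hap : a = 2 * (p : ℝ) - 1)
    (ha : 1 / 2 < a) : ∃ L : Ω → ℝ, Measurable L ∧
      (∀ᵐ ω ∂P, Tendsto (fun n : ℕ => walkPosition X n ω / (n : ℝ) ^ a) atTop (𝓝 (L ω))) ∧
      P.map L ∈ lawsWithMean (1 / Real.Gamma (1 + a)) ∧
      P.map L = smoothingMap p a (P.map L) := by
  obtain ⟨L, hLm, hL2, hLmean, hL⟩ := hX.exists_limit hap ha
  refine ⟨L, hLm, hL, ⟨Measure.isProbabilityMeasure_map hLm.aemeasurable, ?_, ?_⟩,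
    hX.map_limit_eq_smoothingMap hLm hL⟩
  · exact (memLp_map_measure_iff (by fun_prop) hLm.aemeasurable).2 hL2
  · rw [integral_map hLm.aemeasurable (by fun_prop), hLmean]

end IsElephantWalk

/-! ### Existence of the walk -/

/-- The steps of the walk driven by the draws `ω n = (K, ξ)` made after step `n + 1`. -/
def drivenStep (ω : ℕ → ℕ × ℝ) : ℕ → ℝ
  | 0 => 0
  | 1 => 1
  -- Summing over `Fin (n + 2)` restricts the recursive calls to earlier indices; a draw out of
  -- range gives 0.
  | n + 2 => (2 * (ω n).2 - 1) *
      ∑ k : Fin (n + 2), if (ω n).1 = k then drivenStep ω k else 0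

theorem drivenStep_zero (ω : ℕ → ℕ × ℝ) : drivenStep ω 0 = 0 := by rw [drivenStep]

theorem drivenStep_one (ω : ℕ → ℕ × ℝ) : drivenStep ω 1 = 1 := by rw [drivenStep]

theorem drivenStep_add_two (ω : ℕ → ℕ × ℝ) (n : ℕ) : drivenStep ω (n + 2) =
    (2 * (ω n).2 - 1) * ∑ k : Fin (n + 2), if (ω n).1 = k then drivenStep ω k else 0 := by
  rw [drivenStep]

theorem measurable_drivenStep (n : ℕ) : Measurable fun ω => drivenStep ω n := by
  induction n using Nat.strong_induction_on with
  | _ n ih =>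
    match n with
    | 0 => simpa only [drivenStep_zero] using measurable_const
    | 1 => simpa only [drivenStep_one] using measurable_const
    | n + 2 =>
      simp only [drivenStep_add_two]
      refine Measurable.mul (by fun_prop) (Finset.measurable_fun_sum _ fun k _ => ?_)
      refine Measurable.ite ?_ (ih k k.2) measurable_const
      exact (measurable_fst.comp (measurable_pi_apply n)) (measurableSet_singleton (k : ℕ))

theorem drivenStep_congr {ω ω' : ℕ → ℕ × ℝ} {n : ℕ} (h : ∀ i, i + 2 ≤ n → ω i = ω' i) :
    drivenStep ω n = drivenStep ω' n := by
  induction n using Nat.strong_induction_on with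
  | _ n ih =>
    match n with
    | 0 => simp only [drivenStep_zero]
    | 1 => simp only [drivenStep_one]
    | n + 2 =>
      rw [drivenStep_add_two, drivenStep_add_two, h n le_rfl]
      congr 1
      refine Finset.sum_congr rfl fun k _ => ?_
      rw [ih k k.2 fun i hi => h i (by omega)]

/-- The law of the draw made after step `n + 1`. -/
noncomputable def drawLaw (p : I) (n : ℕ) : Measure (ℕ × ℝ) :=
  (uniformOn (Set.Icc 1 (n + 1))).prod (bernoulliMeasure (1 : ℝ) 0 p)

instance isProbabilityMeasure_uniformOn_Icc (n : ℕ) :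
    IsProbabilityMeasure (uniformOn (Set.Icc 1 (n + 1))) :=
  isProbabilityMeasure_uniformOn (Set.finite_Icc _ _) ⟨1, by simp⟩

instance isProbabilityMeasure_drawLaw (p : I) (n : ℕ) : IsProbabilityMeasure (drawLaw p n) := by
  unfold drawLaw
  infer_instance

theorem isElephantWalk_drivenStep (p : I) :
    IsElephantWalk p 1 (fun n ω => drivenStep ω n) (Measure.infinitePi (drawLaw p)) where
  measurable n _ := measurable_drivenStep n
  first_step := by
    simp only [drivenStep_one, bernoulliMeasure_one]
    exact ⟨by fun_prop, by simp⟩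
  next_step n hn := by
    obtain ⟨m, rfl⟩ : ∃ m, n = m + 1 := ⟨n - 1, by omega⟩
    have hcoord : MeasurePreserving (fun ω : ℕ → ℕ × ℝ => ω m) (Measure.infinitePi (drawLaw p))
        (drawLaw p m) := measurePreserving_eval_infinitePi _ m
    have hfst : MeasurePreserving Prod.fst (drawLaw p m) (uniformOn (Set.Icc 1 (m + 1))) :=
      measurePreserving_fst
    have hsnd : MeasurePreserving Prod.snd (drawLaw p m) (bernoulliMeasure (1 : ℝ) 0 p) :=
      measurePreserving_snd
    have hK := hfst.comp hcoord
    have hξ := hsnd.comp hcoord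
    refine ⟨fun ω => (ω m).1, fun ω => (ω m).2, by fun_prop, by fun_prop, hK.hasLaw, hξ.hasLaw,
      ?_, ?_, ?_⟩
    · refine (indepFun_iff_map_prod_eq_prod_map_map hK.measurable.aemeasurable
        hξ.measurable.aemeasurable).2 ?_
      exact hcoord.map_eq.trans (congrArg₂ Measure.prod hK.map_eq hξ.map_eq).symm
    · have hind : iIndepFun (fun i (ω : ℕ → ℕ × ℝ) => ω i) (Measure.infinitePi (drawLaw p)) :=
        iIndepFun_infinitePi (X := fun _ x => x) fun _ => measurable_id
      have h := hind.indepFun_finset {m} (Finset.range m) (by simp) fun i => measurable_pi_apply i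
      -- The first `m+1` steps read only the draws before `m`, so the padding value `(0, 0)` is
      -- never used.
      set ext : (Finset.range m → ℕ × ℝ) → ℕ → ℕ × ℝ :=
        fun x i => if hi : i ∈ Finset.range m then x ⟨i, hi⟩ else (0, 0) with hext
      have hextm : Measurable ext := by
        refine measurable_pi_lambda _ fun i => ?_
        by_cases hi : i ∈ Finset.range m
        · simpa only [hext, hi, dif_pos] using measurable_pi_apply _
        · simpa only [hext, hi, dif_neg, not_false_eq_true] using measurable_const
      have hφ : Measurable fun x : ({m} : Finset ℕ) → ℕ × ℝ =>
          x ⟨m, Finset.mem_singleton_self m⟩ := measurable_pi_apply _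
      have hψ : Measurable fun (x : Finset.range m → ℕ × ℝ) (i : Finset.Icc 1 (m + 1)) =>
          drivenStep (ext x) i :=
        measurable_pi_lambda _ fun i => (measurable_drivenStep i).comp hextm
      have h' := h.comp hφ hψ
      convert! h' using 1
      funext ω i
      refine drivenStep_congr fun j hj => ?_
      have hi := (Finset.mem_Icc.1 i.2).2
      have hj' : j ∈ Finset.range m := Finset.mem_range.2 (by omega)
      simp only [hext, hj', dif_pos]
    · have hmem : ∀ᵐ k ∂uniformOn (Set.Icc 1 (m + 1)), k ∈ Set.Icc 1 (m + 1) :=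
        ae_cond_mem measurableSet_Icc
      filter_upwards [hK.quasiMeasurePreserving.ae hmem] with ω hω
      rw [drivenStep_add_two]
      congr 1
      have hlt : (ω m).1 < m + 2 := Nat.lt_succ_of_le hω.2
      rw [Finset.sum_eq_single (⟨(ω m).1, hlt⟩ : Fin (m + 2))]
      · simp
      · rintro k - hk
        exact if_neg fun h => hk (Fin.ext h.symm)
      · simp

theorem theorem2 (p : unitInterval) (a : ℝ) (hap : a = 2 * (p : ℝ) - 1)
    (ha : a ∈ Set.Ioo (1 / 2 : ℝ) 1) :
    (∃ μ : Measure ℝ,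
      (∀ (Ω : Type*) (_ : MeasurableSpace Ω) (P : Measure Ω) (_ : IsProbabilityMeasure P)
        (X : ℕ → Ω → ℝ), IsElephantWalk p 1 X P →
          ∃ L : Ω → ℝ, Measurable L ∧
            (∀ᵐ ω ∂P, Tendsto (fun n : ℕ => walkPosition X n ω / (n : ℝ) ^ a) atTop (𝓝 (L ω))) ∧
            HasLaw L μ P) ∧
      (μ ∈ lawsWithMean (1 / Real.Gamma (1 + a)) ∧ μ = smoothingMap p a μ) ∧
      ∀ ν : Measure ℝ,
        ν ∈ lawsWithMean (1 / Real.Gamma (1 + a)) ∧ ν = smoothingMap p a ν → ν = μ) ∧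
    √(2 / (1 + 2 * a)) < 1 ∧
    ∀ m : ℝ,
      (∀ μ ∈ lawsWithMean m, smoothingMap p a μ ∈ lawsWithMean m) ∧
      ∀ μ ∈ lawsWithMean m, ∀ ν ∈ lawsWithMean m,
        wassersteinTwo (smoothingMap p a μ) (smoothingMap p a ν) ≤
          ENNReal.ofReal √(2 / (1 + 2 * a)) * wassersteinTwo μ ν := by
  have ha1 : 1 / 2 < a := ha.1
  have ha0 : 0 < a := by linarith
  -- The explicit walk supplies `μ`; for any other walk, uniqueness identifies the law of its limit
  -- with `μ`.
  obtain ⟨L, -, -, hμ, hfix⟩ := (isElephantWalk_drivenStep p).exists_limit_fixed hap ha1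
  refine ⟨⟨_, fun Ω _ P _ X hX => ?_, ⟨hμ, hfix⟩, fun ν hν =>
      eq_of_smoothingMap_fixed ha1 hν.1 hμ hν.2 hfix⟩, sqrt_two_div_lt_one ha1,
    fun m => ⟨fun μ hμ => smoothingMap_mem_lawsWithMean hap ha0 hμ,
      fun μ hμ ν hν => wassersteinTwo_smoothingMap_le ha0 hμ hν⟩⟩
  obtain ⟨L', hLm, hL, hμ', hfix'⟩ := hX.exists_limit_fixed hap ha1
  exact ⟨L', hLm, hL, hLm.aemeasurable, eq_of_smoothingMap_fixed ha1 hμ' hμ hfix' hfix⟩
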